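/- Let $\Gamma=(V,E)$ be an infinite, locally finite tree with a distinguished root $\bar 0$ and without vertices of degree $1$. The AKLT model on $\Gamma$ has at each vertex $x$ a spin $\deg(x)/2$, with Hilbert space $\mathcal H_x=\mathbb C^{\deg(x)+1}$. For $n\ge 0$ let $T_n$ be the subtree induced on the vertices at distance at most $n$ from $\bar 0$, and let $$H_n=\sum_{\{x,y\}\in E(T_n)}P_{xy}$$ on $\bigotimes_{x\in T_n}\mathcal H_x$, where $P_{xy}$ is the orthogonal projection onto the subspace in which the spins at $x$ and $y$ have the maximal total spin $(\deg(x)+\deg(y))/2$; the degrees are those in $\Gamma$, so the vertices at distance $n$ keep their full spin. A finite-volume ground state on $T_n$ is a state given by a density matrix $\rho_n$ with $H_n\rho_n=0$ (equivalently, one obtained from a boundary condition on the edges that leave $T_n$). An infinite-volume ground state is a functional $\omega$ on the local observables such that $\omega(A)=\lim_{n\to\infty}\mathrm{Tr}(\rho_n A)$ for all local observables $A$, for some sequence of finite-volume ground states $\rho_n$ on $T_n$. Suppose there are $\mu>1$ and $C>0$ such that for every infinite path $\bar 0=x_0,x_1,x_2,\dots$ in $\Gamma$ with $|x_k-\bar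 0|=k$ for all $k$, and for every $n\ge 0$, $$\prod_{k=1}^n\frac{\deg(x_k)-1}{3}\ \ge\ C\mu^n .$$ Then the AKLT ground state on $\Gamma$ is not unique: there are two different infinite-volume ground states. -/

import Mathlib

open Filter Topology
open scoped ComplexOrder

noncomputable section

namespace AKLT

/-! ### Spin operators

A site carrying the spin `s = d / 2` has the Hilbert space `ℂ ^ (d + 1)`; the basis vector number `j`
is the normalized eigenvector of `S^z` with eigenvalue `j - d / 2`. -/

/-- `S^z` in the spin `d / 2` representation of `su(2)`. -/
def spinZ (d : ℕ) : Matrix (Fin (d + 1)) (Fin (d + 1)) ℂ :=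
  Matrix.diagonal fun j => ((j : ℕ) : ℂ) - (d : ℂ) / 2

/-- The raising operator `S^+ = S^x + i S^y` in the spin `d / 2` representation:
`S^+ |j⟩ = √((j + 1) (d - j)) |j + 1⟩`. -/
def spinRaise (d : ℕ) : Matrix (Fin (d + 1)) (Fin (d + 1)) ℂ :=
  Matrix.of fun i j =>
    if (i : ℕ) = (j : ℕ) + 1 then
      ((Real.sqrt ((((j : ℕ) : ℝ) + 1) * ((d : ℝ) - ((j : ℕ) : ℝ))) : ℝ) : ℂ)
    else 0

/-- `S^x` in the spin `d / 2` representation. -/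
def spinX (d : ℕ) : Matrix (Fin (d + 1)) (Fin (d + 1)) ℂ :=
  (1 / 2 : ℂ) • (spinRaise d + (spinRaise d).conjTranspose)

/-- `S^y` in the spin `d / 2` representation. -/
def spinY (d : ℕ) : Matrix (Fin (d + 1)) (Fin (d + 1)) ℂ :=
  (1 / (2 * Complex.I) : ℂ) • (spinRaise d - (spinRaise d).conjTranspose)

/-! ### Finite regions

`d x` is twice the spin at the site `x`. -/

/-- The labels of the product basis of `⨂_{x ∈ Λ} ℂ ^ (d x + 1)`. -/
abbrev Conf {V : Type*} (d : V → ℕ) (Λ : Finset V) : Type _ :=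
  (x : Λ) → Fin (d x + 1)

/-- Operators on `⨂_{x ∈ Λ} ℂ ^ (d x + 1)`, that is, the observables supported in `Λ`. -/
abbrev Obs {V : Type*} (d : V → ℕ) (Λ : Finset V) : Type _ :=
  Matrix (Conf d Λ) (Conf d Λ) ℂ

/-- The operator `M ⊗ 1` with `M` acting on the site `x` and the identity on the other sites. -/
def onSite {V : Type*} [DecidableEq V] {d : V → ℕ} {Λ : Finset V} (x : Λ)
    (M : Matrix (Fin (d x + 1)) (Fin (d x + 1)) ℂ) : Obs d Λ :=
  Matrix.of fun σ τ => if ∀ y : Λ, y ≠ x → σ y = τ y then M (σ x) (τ x) else 0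

/-- The operator `A ⊗ 1` on the region `Λ'` for `A` supported in `Λ ⊆ Λ'`. -/
def extend {V : Type*} [DecidableEq V] {d : V → ℕ} {Λ Λ' : Finset V} (h : Λ ⊆ Λ')
    (A : Obs d Λ) : Obs d Λ' :=
  Matrix.of fun σ τ =>
    if ∀ y : Λ', (y : V) ∉ Λ → σ y = τ y then
      A (fun x => σ ⟨x, h x.2⟩) (fun x => τ ⟨x, h x.2⟩)
    else 0

/-- The Casimir operator `∑_{α = x, y, z} (S_x^α + S_y^α)²` of the total spin of the sites
`x` and `y`. -/
def pairCasimir {V : Type*} [DecidableEq V] (d : V → ℕ) (Λ : Finset V) (x y : Λ) : Obs d Λ :=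
  (onSite x (spinX (d x)) + onSite y (spinX (d y))) ^ 2
    + (onSite x (spinY (d x)) + onSite y (spinY (d y))) ^ 2
    + (onSite x (spinZ (d x)) + onSite y (spinZ (d y))) ^ 2

/-- The subspace of the vectors for which the sites `x` and `y` have the maximal total spin
`J = (d x + d y) / 2`: the eigenspace of the Casimir operator for `J (J + 1)`. -/
def maxSpinSpace {V : Type*} [DecidableEq V] (d : V → ℕ) (Λ : Finset V) (x y : Λ) :
    Submodule ℂ (EuclideanSpace ℂ (Conf d Λ)) :=
  Module.End.eigenspace (Matrix.toEuclideanLin (pairCasimir d Λ x y))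
    ((((d x : ℂ) + (d y : ℂ)) / 2) * (((d x : ℂ) + (d y : ℂ)) / 2 + 1))

/-- The AKLT Hamiltonian of the region `Λ`: each edge of `G` with both ends in `Λ` contributes the
orthogonal projection onto the maximal total spin of its two ends, where the site `x` carries the
spin `deg x / 2` (the degree being that in the whole graph `G`). The double sum runs over ordered
pairs and meets each edge twice, whence the factor `1 / 2`. -/
def hamiltonian {V : Type*} [DecidableEq V] (G : SimpleGraph V) [G.LocallyFinite]
    [DecidableRel G.Adj] (Λ : Finset V) :
    EuclideanSpace ℂ (Conf (fun v => G.degree v) Λ) →L[ℂ]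
      EuclideanSpace ℂ (Conf (fun v => G.degree v) Λ) :=
  (1 / 2 : ℂ) • ∑ x : Λ, ∑ y : Λ,
    if G.Adj x y then (maxSpinSpace (fun v => G.degree v) Λ x y).starProjection else 0

/-- `ρ` is the density matrix of a (pure or mixed) ground state of the region `Λ`: a positive
semidefinite matrix of trace one whose range lies in the kernel of the Hamiltonian. -/
structure IsGroundState {V : Type*} [DecidableEq V] (G : SimpleGraph V) [G.LocallyFinite]
    [DecidableRel G.Adj] (Λ : Finset V) (ρ : Obs (fun v => G.degree v) Λ) : Prop where
  posSemidef : ρ.PosSemidef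
  trace_eq_one : ρ.trace = 1
  hamiltonian_eq_zero : ∀ ψ, hamiltonian G Λ (Matrix.toEuclideanLin ρ ψ) = 0

/-! ### The infinite volume -/

/-- The set of the vertices at distance at most `n` from the root `o`. -/
def ball {V : Type*} [DecidableEq V] (G : SimpleGraph V) [G.LocallyFinite] (o : V) :
    ℕ → Finset V
  | 0 => {o}
  | n + 1 => ball G o n ∪ (ball G o n).biUnion fun v => G.neighborFinset v

theorem mem_ball {V : Type*} [DecidableEq V] (G : SimpleGraph V) [G.LocallyFinite]
    (hG : G.Connected) (o x : V) (n : ℕ) : x ∈ ball G o n ↔ G.dist o x ≤ n := by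
  induction n generalizing x with
  | zero => simp [ball, hG.dist_eq_zero_iff, eq_comm]
  | succ n ih =>
    simp only [ball, Finset.mem_union, Finset.mem_biUnion, SimpleGraph.mem_neighborFinset, ih]
    constructor
    · rintro (h | ⟨y, hy, hyx⟩)
      · omega
      · have h1 := hG.dist_triangle (u := o) (v := y) (w := x)
        have h2 : G.dist y x = 1 := SimpleGraph.dist_eq_one_iff_adj.2 hyx
        omega
    · intro h
      by_cases hn : G.dist o x ≤ n
      · exact Or.inl hn
      · right
        obtain ⟨p, hp⟩ := hG.exists_walk_length_eq_dist x o
        cases p with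
        | nil => simp at hn
        | cons hadj q =>
          refine ⟨_, ?_, hadj.symm⟩
          have h1 := SimpleGraph.dist_le q
          rw [SimpleGraph.Walk.length_cons, SimpleGraph.dist_comm] at hp
          rw [SimpleGraph.dist_comm] at h1
          omega

/-- The expectation `Tr (ρ (A ⊗ 1))` of the observable `A` supported in `Λ` in the state on the
region `Λ'` with density matrix `ρ`; by convention `0` unless `Λ ⊆ Λ'`. -/
def expectation {V : Type*} [DecidableEq V] {d : V → ℕ} {Λ' : Finset V} (ρ : Obs d Λ')
    (Λ : Finset V) (A : Obs d Λ) : ℂ :=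
  if h : Λ ⊆ Λ' then (ρ * extend h A).trace else 0

/-- The infinite-volume ground states of the AKLT model on `G`: the functionals `ω` on the local
observables that are weak limits, as `n → ∞`, of ground states of the balls of radius `n` around
the root `o`. -/
def infiniteVolumeGroundStates {V : Type*} [DecidableEq V] (G : SimpleGraph V) [G.LocallyFinite]
    [DecidableRel G.Adj] (o : V) :
    Set ((Λ : Finset V) → Obs (fun v => G.degree v) Λ → ℂ) :=
  {ω | ∃ ρ : (n : ℕ) → Obs (fun v => G.degree v) (ball G o n),
    (∀ n, IsGroundState G (ball G o n) (ρ n)) ∧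
    ∀ (Λ : Finset V) (A : Obs (fun v => G.degree v) Λ),
      Tendsto (fun n => expectation (ρ n) Λ A) atTop (𝓝 (ω Λ A))}

end AKLT

end

/-! Each spin is written with Schwinger bosons of two kinds. The singlet creator `bond` on an edge
satisfies `bond_mul_conjTranspose`: `bond * bondᴴ` is `J(J+1)` minus the pair Casimir, where `J` is
the maximal spin. Hence its range is orthogonal to the maximal-spin space, and a vector that is in
the range of the bond operator of every edge is a ground state. This property survives partial
traces, so compactness turns bonded states on balls into infinite-volume ground states.

A tree is bipartite. Take Néel boundary conditions: every edge leaving the ball puts a boson of the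
first kind on one sublattice and of the second kind on the other. Expanding the singlets gives a sum
over sets of marked edges. On a tree distinct sets give distinct, hence orthogonal, configurations,
and the squared norm becomes a classical partition function: a variable `t` in `[0, 1]` at each
vertex, and for each inner edge the factor `t s + (1 - t)(1 - s)`, that is `(1 + (2t - 1)(2s - 1)) /
2`. The root spin corresponds to inserting a multiple of `2t - 1` at the root (`integral_mul_occ`).

The partition function is computed by peeling leaves (`partition_eq`). The message from a vertex to
its parent is proportional to `1 + β (2t - 1)`. If the incoming slopes have sum `S`, then
`integral_prod_affine_le` gives `1/β ≤ 3 + 3/S`. An upper bound `b` for the inverse slopes of the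
`m` children thus becomes `3 + 3 b / m`, with `m = deg - 1`. Unrolled along a path, this is a series
in the products of `3 / (deg - 1)`, which the hypothesis dominates by a geometric series
(`isTilted_message`).

So the root magnetization stays above a positive constant in all balls (`exists_le_magnetization`).
Exchanging the two sublattices changes its sign, and the two limits differ. -/

noncomputable section

namespace AKLT

/-! ### Operators on one site -/

section OneSite

/-- The matrix with the entries `a 0, a 1, …` directly below the diagonal. -/
def lowerShift (d : ℕ) (a : ℕ → ℝ) : Matrix (Fin (d + 1)) (Fin (d + 1)) ℂ :=
  Matrix.of fun i j => if (i : ℕ) = (j : ℕ) + 1 then ((a j : ℝ) : ℂ) else 0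

theorem lowerShift_mul_conjTranspose (d : ℕ) (a b : ℕ → ℝ) :
    lowerShift d a * (lowerShift d b).conjTranspose =
      Matrix.diagonal fun i : Fin (d + 1) => if (i : ℕ) = 0 then 0 else
        ((a ((i : ℕ) - 1) * b ((i : ℕ) - 1) : ℝ) : ℂ) := by
  ext i k
  simp only [Matrix.mul_apply, lowerShift, Matrix.conjTranspose_apply, Matrix.of_apply,
    Matrix.diagonal_apply]
  by_cases hi : (i : ℕ) = 0
  · rw [Finset.sum_eq_zero]
    · simp [hi]
    · intro j _
      rw [if_neg (by omega), zero_mul]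
  · rw [Finset.sum_eq_single (⟨i - 1, by omega⟩ : Fin (d + 1))]
    · by_cases hik : i = k
      · subst hik
        have : (i : ℕ) = (i : ℕ) - 1 + 1 := by omega
        simp [hi, ← this]
      · have : ¬ (k : ℕ) = (i : ℕ) - 1 + 1 := fun h => hik (Fin.ext (by omega))
        simp [hik, this]
    · intro j _ hj
      rw [if_neg, zero_mul]
      intro h
      exact hj (Fin.ext (by simp; omega))
    · simp

theorem conjTranspose_mul_lowerShift (d : ℕ) (a b : ℕ → ℝ) :
    (lowerShift d a).conjTranspose * lowerShift d b =
      Matrix.diagonal fun j : Fin (d + 1) => if (j : ℕ) < d then ((a j * b j : ℝ) : ℂ) else 0 := by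
  ext i k
  simp only [Matrix.mul_apply, lowerShift, Matrix.conjTranspose_apply, Matrix.of_apply,
    Matrix.diagonal_apply]
  by_cases hi : (i : ℕ) < d
  · rw [Finset.sum_eq_single (⟨i + 1, by omega⟩ : Fin (d + 1))]
    · by_cases hik : i = k
      · subst hik
        simp [hi]
      · have : ¬ (i : ℕ) = (k : ℕ) := fun h => hik (Fin.ext h)
        simp [hik, this]
    · intro j _ hj
      rw [if_neg, star_zero, zero_mul]
      intro h
      exact hj (Fin.ext h)
    · simp
  · rw [Finset.sum_eq_zero]
    · simp [hi]
    · intro j _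
      rw [if_neg (by omega), star_zero, zero_mul]

/-- The creation operator of a boson of the first kind, for `d` bosons of two kinds. -/
def create (d : ℕ) : Matrix (Fin (d + 1)) (Fin (d + 1)) ℂ :=
  lowerShift d fun j => Real.sqrt ((j : ℝ) + 1)

/-- The creation operator of a boson of the second kind, for `d` bosons of two kinds. -/
def createTwo (d : ℕ) : Matrix (Fin (d + 1)) (Fin (d + 1)) ℂ :=
  Matrix.diagonal fun j => ((Real.sqrt ((d : ℝ) - (j : ℕ)) : ℝ) : ℂ)

theorem spinRaise_eq (d : ℕ) :
    spinRaise d = lowerShift d fun j => Real.sqrt (((j : ℝ) + 1) * ((d : ℝ) - j)) := rfl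

theorem createTwo_conjTranspose (d : ℕ) : (createTwo d).conjTranspose = createTwo d := by
  rw [createTwo, Matrix.diagonal_conjTranspose]
  congr 1
  ext j
  simp

/-- This is `S⁺ = a† b`. The creators map `d - 1` bosons to `d`; their domain, indexed by the number
of first-kind bosons, is padded by the index `d`, which both annihilate. In this indexing `b†` is
diagonal, so it equals `b`. -/
theorem create_mul_createTwo (d : ℕ) : create d * createTwo d = spinRaise d := by
  ext i j
  rw [create, createTwo, Matrix.mul_diagonal, spinRaise_eq]
  simp only [lowerShift, Matrix.of_apply]
  split_ifs
  · rw [Real.sqrt_mul (by positivity)]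
    push_cast
    ring
  · simp

theorem createTwo_mul_conjTranspose_create (d : ℕ) :
    createTwo d * (create d).conjTranspose = (spinRaise d).conjTranspose := by
  rw [← create_mul_createTwo, Matrix.conjTranspose_mul, createTwo_conjTranspose]

theorem fin_cast_le (d : ℕ) (j : Fin (d + 1)) : ((j : ℕ) : ℝ) ≤ d := by
  exact_mod_cast Nat.lt_succ_iff.1 j.2

theorem createTwo_mul_self (d : ℕ) :
    createTwo d * createTwo d = ((d : ℂ) / 2) • 1 - spinZ d := by
  rw [createTwo, Matrix.diagonal_mul_diagonal, spinZ, Matrix.smul_one_eq_diagonal,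
    Matrix.diagonal_sub]
  congr 1
  ext j
  rw [← Complex.ofReal_mul, Real.mul_self_sqrt (by linarith [fin_cast_le d j])]
  push_cast
  ring

theorem create_mul_conjTranspose (d : ℕ) :
    create d * (create d).conjTranspose = ((d : ℂ) / 2) • 1 + spinZ d := by
  rw [create, lowerShift_mul_conjTranspose, spinZ, Matrix.smul_one_eq_diagonal,
    Matrix.diagonal_add]
  congr 1
  ext j
  split_ifs with h
  · simp [h]
  · rw [Real.mul_self_sqrt (by positivity), Nat.cast_sub (by omega)]
    push_cast
    ring

/-- Twice the one-site Casimir, since `S⁺S⁻ + S⁻S⁺ = 2 (Sx² + Sy²)`. -/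
theorem spinRaise_mul_conjTranspose_add (d : ℕ) :
    spinRaise d * (spinRaise d).conjTranspose + (spinRaise d).conjTranspose * spinRaise d
      + (2 : ℂ) • (spinZ d * spinZ d) = (2 * ((d : ℂ) / 2 * ((d : ℂ) / 2 + 1))) • 1 := by
  rw [spinRaise_eq, lowerShift_mul_conjTranspose, conjTranspose_mul_lowerShift, spinZ,
    Matrix.diagonal_mul_diagonal, Matrix.smul_one_eq_diagonal, ← Matrix.diagonal_smul,
    Matrix.diagonal_add, Matrix.diagonal_add]
  congr 1
  ext j
  have hj := fin_cast_le d j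
  have h1 : (if (j : ℕ) = 0 then 0 else
      ((Real.sqrt ((((j - 1 : ℕ) : ℝ) + 1) * ((d : ℝ) - ((j - 1 : ℕ) : ℝ))) *
        Real.sqrt ((((j - 1 : ℕ) : ℝ) + 1) * ((d : ℝ) - ((j - 1 : ℕ) : ℝ))) : ℝ) : ℂ)) =
      (j : ℕ) * ((d : ℂ) - (j : ℕ) + 1) := by
    split_ifs with h
    · simp [h]
    · have : ((j - 1 : ℕ) : ℝ) = (j : ℕ) - 1 := by rw [Nat.cast_sub (by omega)]; simp
      rw [this, Real.mul_self_sqrt]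
      · push_cast
        ring
      · have : (1 : ℝ) ≤ (j : ℕ) := by exact_mod_cast Nat.one_le_iff_ne_zero.2 h
        apply mul_nonneg <;> linarith
  have h2 : (if (j : ℕ) < d then
      ((Real.sqrt ((((j : ℕ) : ℝ) + 1) * ((d : ℝ) - ((j : ℕ) : ℝ))) *
        Real.sqrt ((((j : ℕ) : ℝ) + 1) * ((d : ℝ) - ((j : ℕ) : ℝ))) : ℝ) : ℂ) else 0) =
      ((j : ℕ) + 1) * ((d : ℂ) - (j : ℕ)) := by
    split_ifs with h
    · rw [Real.mul_self_sqrt]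
      · push_cast
        ring
      · apply mul_nonneg
        · positivity
        · linarith
    · have : (j : ℕ) = d := by omega
      simp [this]
  rw [h1, h2]
  simp only [Pi.smul_apply, smul_eq_mul]
  ring

end OneSite

/-! ### Operators on a region -/

section Region

variable {V : Type*} [DecidableEq V] {d : V → ℕ} {Λ : Finset V}

theorem onSite_mulVec (x : Λ) (M : Matrix (Fin (d x + 1)) (Fin (d x + 1)) ℂ)
    (χ : Conf d Λ → ℂ) (σ : Conf d Λ) :
    (onSite x M).mulVec χ σ = ∑ j, M (σ x) j * χ (Function.update σ x j) := by
  simp only [Matrix.mulVec, dotProduct, onSite, Matrix.of_apply]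
  symm
  apply Fintype.sum_of_injective (fun j => Function.update σ x j)
    (Function.update_injective σ x)
  · intro τ hτ
    rw [if_neg, zero_mul]
    intro h
    refine hτ ⟨τ x, ?_⟩
    ext y
    by_cases hy : y = x
    · subst hy; simp
    · simp [Function.update_of_ne hy, h y hy]
  · intro j
    rw [if_pos]
    · simp
    · intro y hy
      simp [Function.update_of_ne hy]

theorem onSite_add (x : Λ) (M N : Matrix (Fin (d x + 1)) (Fin (d x + 1)) ℂ) :
    onSite x (M + N) = onSite x M + onSite x N := by
  ext σ τ
  simp only [onSite, Matrix.of_apply, Matrix.add_apply]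
  split_ifs <;> simp

theorem onSite_smul (x : Λ) (c : ℂ) (M : Matrix (Fin (d x + 1)) (Fin (d x + 1)) ℂ) :
    onSite x (c • M) = c • onSite x M := by
  ext σ τ
  simp only [onSite, Matrix.of_apply, Matrix.smul_apply]
  split_ifs <;> simp

theorem onSite_sub (x : Λ) (M N : Matrix (Fin (d x + 1)) (Fin (d x + 1)) ℂ) :
    onSite x (M - N) = onSite x M - onSite x N := by
  ext σ τ
  simp only [onSite, Matrix.of_apply, Matrix.sub_apply]
  split_ifs <;> simp

theorem onSite_conjTranspose (x : Λ) (M : Matrix (Fin (d x + 1)) (Fin (d x + 1)) ℂ) :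
    (onSite x M).conjTranspose = onSite x M.conjTranspose := by
  ext σ τ
  simp only [onSite, Matrix.of_apply, Matrix.conjTranspose_apply]
  have : (∀ y : Λ, y ≠ x → τ y = σ y) ↔ ∀ y : Λ, y ≠ x → σ y = τ y :=
    forall₂_congr fun _ _ => eq_comm
  by_cases h : ∀ y : Λ, y ≠ x → σ y = τ y
  · rw [if_pos h, if_pos (this.2 h)]
  · rw [if_neg h, if_neg (fun h' => h (this.1 h')), star_zero]

theorem onSite_one (x : Λ) : (onSite x 1 : Obs d Λ) = 1 := by
  apply Matrix.mulVec_injective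
  ext χ σ
  rw [onSite_mulVec, Finset.sum_eq_single (σ x)]
  · simp
  · intro j _ hj
    simp [Matrix.one_apply_ne' hj]
  · simp

theorem onSite_mul (x : Λ) (M N : Matrix (Fin (d x + 1)) (Fin (d x + 1)) ℂ) :
    onSite x M * onSite x N = onSite x (M * N) := by
  apply Matrix.mulVec_injective
  ext χ σ
  simp only [← Matrix.mulVec_mulVec, onSite_mulVec, Function.update_self, Function.update_idem,
    Matrix.mul_apply, Finset.mul_sum, Finset.sum_mul]
  rw [Finset.sum_comm]
  simp only [mul_assoc]

theorem onSite_comm {x y : Λ} (h : x ≠ y) (M : Matrix (Fin (d x + 1)) (Fin (d x + 1)) ℂ)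
    (N : Matrix (Fin (d y + 1)) (Fin (d y + 1)) ℂ) :
    onSite x M * onSite y N = onSite y N * onSite x M := by
  apply Matrix.mulVec_injective
  ext χ σ
  simp only [← Matrix.mulVec_mulVec, onSite_mulVec, Function.update_of_ne h,
    Function.update_of_ne h.symm, Finset.mul_sum]
  rw [Finset.sum_comm]
  refine Finset.sum_congr rfl fun j _ => Finset.sum_congr rfl fun i _ => ?_
  rw [Function.update_comm h]
  ring

/-- The creation of a valence bond (a singlet) between the sites `x` and `y`. -/
def bond (d : V → ℕ) (Λ : Finset V) (x y : Λ) : Obs d Λ :=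
  onSite x (create (d x)) * onSite y (createTwo (d y))
    - onSite x (createTwo (d x)) * onSite y (create (d y))

theorem bond_swap {x y : Λ} (h : x ≠ y) : bond d Λ y x = -bond d Λ x y := by
  rw [bond, bond, onSite_comm h, onSite_comm h, neg_sub]

/-- Expand the square of the total spin: the one-site Casimirs are scalars, and the cross term `2
S_x · S_y` is written with ladder operators. -/
theorem pairCasimir_eq {x y : Λ} (h : x ≠ y) :
    pairCasimir d Λ x y =
      ((d x : ℂ) / 2 * ((d x : ℂ) / 2 + 1) + (d y : ℂ) / 2 * ((d y : ℂ) / 2 + 1)) • 1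
      + (onSite x (spinRaise (d x)) * onSite y (spinRaise (d y)).conjTranspose
        + onSite x (spinRaise (d x)).conjTranspose * onSite y (spinRaise (d y))
        + (2 : ℂ) • (onSite x (spinZ (d x)) * onSite y (spinZ (d y)))) := by
  have key : ∀ z : Λ, onSite z (spinRaise (d z)) * onSite z (spinRaise (d z)).conjTranspose
      + onSite z (spinRaise (d z)).conjTranspose * onSite z (spinRaise (d z))
      + (2 : ℂ) • (onSite z (spinZ (d z)) * onSite z (spinZ (d z))) =
      (2 * ((d z : ℂ) / 2 * ((d z : ℂ) / 2 + 1))) • (1 : Obs d Λ) := by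
    intro z
    rw [onSite_mul, onSite_mul, onSite_mul, ← onSite_smul, ← onSite_add, ← onSite_add,
      spinRaise_mul_conjTranspose_add, onSite_smul, onSite_one]
  have kx := key x
  have ky := key y
  have c1 := onSite_comm h (spinRaise (d x)) (spinRaise (d y))
  have c2 := onSite_comm h (spinRaise (d x)) (spinRaise (d y)).conjTranspose
  have c3 := onSite_comm h (spinRaise (d x)).conjTranspose (spinRaise (d y))
  have c4 := onSite_comm h (spinRaise (d x)).conjTranspose (spinRaise (d y)).conjTranspose
  have c5 := onSite_comm h (spinZ (d x)) (spinZ (d y))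
  have hI : (1 / (2 * Complex.I) : ℂ) * (1 / (2 * Complex.I)) = -(1 / 4) := by
    field_simp
    rw [Complex.I_sq]; norm_num
  simp only [pairCasimir, spinX, spinY, onSite_smul, onSite_add, onSite_sub]
  generalize onSite x (spinRaise (d x)) = a at *
  generalize onSite x (spinRaise (d x)).conjTranspose = a' at *
  generalize onSite y (spinRaise (d y)) = b at *
  generalize onSite y (spinRaise (d y)).conjTranspose = b' at *
  generalize onSite x (spinZ (d x)) = z at *
  generalize onSite y (spinZ (d y)) = w at *
  have e1 : ((1 / 2 : ℂ) • (a + a') + (1 / 2 : ℂ) • (b + b')) ^ 2 =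
      (1 / 4 : ℂ) • ((a + a' + (b + b')) * (a + a' + (b + b'))) := by
    rw [← smul_add, pow_two, smul_mul_smul_comm]; norm_num
  have e2 : ((1 / (2 * Complex.I) : ℂ) • (a - a') + (1 / (2 * Complex.I) : ℂ) • (b - b')) ^ 2 =
      -((1 / 4 : ℂ) • ((a - a' + (b - b')) * (a - a' + (b - b')))) := by
    rw [← smul_add, pow_two, smul_mul_smul_comm, hI, neg_smul]
  have e3 : (z + w) ^ 2 = z * z + w * w + (2 : ℂ) • (z * w) := by
    rw [pow_two, add_mul, mul_add, mul_add, ← c5, two_smul]; abel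
  have e4 : (1 / 4 : ℂ) • ((a + a' + (b + b')) * (a + a' + (b + b')))
      + -((1 / 4 : ℂ) • ((a - a' + (b - b')) * (a - a' + (b - b')))) =
      (1 / 2 : ℂ) • (a * a' + a' * a + (b * b' + b' * b)) + (a * b' + a' * b) := by
    rw [← sub_eq_add_neg, ← smul_sub]
    have : (a + a' + (b + b')) * (a + a' + (b + b')) - (a - a' + (b - b')) * (a - a' + (b - b'))
      = (2 : ℂ) • (a * a' + a' * a + (b * b' + b' * b)) + (4 : ℂ) • (a * b' + a' * b) := by
      have h2 : ∀ m : Obs d Λ, (2 : ℂ) • m = m + m := fun m => two_smul _ _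
      have h4 : ∀ m : Obs d Λ, (4 : ℂ) • m = m + m + (m + m) := fun m => by
        rw [← h2, ← h2, smul_smul]; norm_num
      rw [h2, h4]
      simp only [add_mul, mul_add, sub_mul, mul_sub, ← c1, ← c2, ← c3, ← c4]
      abel
    rw [this, smul_add, smul_smul, smul_smul]
    norm_num
  rw [e1, e2, e4, e3]
  have e5 : (1 / 2 : ℂ) • (a * a' + a' * a + (b * b' + b' * b)) + (z * z + w * w) =
      ((d x : ℂ) / 2 * ((d x : ℂ) / 2 + 1) + (d y : ℂ) / 2 * ((d y : ℂ) / 2 + 1)) • 1 := by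
    have hx : (1 / 2 : ℂ) • (a * a' + a' * a + (2 : ℂ) • (z * z)) =
        ((d x : ℂ) / 2 * ((d x : ℂ) / 2 + 1)) • (1 : Obs d Λ) := by
      rw [kx, smul_smul]; congr 1; ring
    have hy : (1 / 2 : ℂ) • (b * b' + b' * b + (2 : ℂ) • (w * w)) =
        ((d y : ℂ) / 2 * ((d y : ℂ) / 2 + 1)) • (1 : Obs d Λ) := by
      rw [ky, smul_smul]; congr 1; ring
    rw [add_smul, ← hx, ← hy]
    simp only [smul_add, smul_smul]
    norm_num
    abel
  rw [← e5]
  abel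

/-- With `aa† → d/2 + S^z` and `bb† → d/2 - S^z`, the product is `d_x d_y / 2 - 2 S_x · S_y`, and
`d_x d_y / 2` is the excess of `J(J+1)` over the two one-site Casimirs. -/
theorem bond_mul_conjTranspose {x y : Λ} (h : x ≠ y) :
    bond d Λ x y * (bond d Λ x y).conjTranspose =
      ((((d x : ℂ) + (d y : ℂ)) / 2) * (((d x : ℂ) + (d y : ℂ)) / 2 + 1)) • 1
        - pairCasimir d Λ x y := by
  rw [pairCasimir_eq h]
  have hc : (bond d Λ x y).conjTranspose =
      onSite x (create (d x)).conjTranspose * onSite y (createTwo (d y))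
        - onSite x (createTwo (d x)) * onSite y (create (d y)).conjTranspose := by
    rw [bond, Matrix.conjTranspose_sub, Matrix.conjTranspose_mul, Matrix.conjTranspose_mul,
      onSite_conjTranspose, onSite_conjTranspose, onSite_conjTranspose, onSite_conjTranspose,
      createTwo_conjTranspose, createTwo_conjTranspose, onSite_comm h, onSite_comm h]
  have mid : ∀ (M N : Matrix (Fin (d x + 1)) (Fin (d x + 1)) ℂ)
      (P Q : Matrix (Fin (d y + 1)) (Fin (d y + 1)) ℂ),
      (onSite x M * onSite y P) * (onSite x N * onSite y Q) =
        onSite x (M * N) * onSite y (P * Q) := by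
    intro M N P Q
    rw [← onSite_mul, ← onSite_mul, mul_assoc, ← mul_assoc (onSite y P), ← onSite_comm h]
    simp only [mul_assoc]
  rw [hc, bond, sub_mul, mul_sub, mul_sub, mid, mid, mid, mid, create_mul_conjTranspose,
    create_mul_conjTranspose, createTwo_mul_self, createTwo_mul_self, create_mul_createTwo,
    create_mul_createTwo, createTwo_mul_conjTranspose_create, createTwo_mul_conjTranspose_create]
  simp only [onSite_add, onSite_sub, onSite_smul, onSite_one]
  generalize onSite x (spinZ (d x)) = z
  generalize onSite y (spinZ (d y)) = w
  generalize onSite x (spinRaise (d x)) * onSite y (spinRaise (d y)).conjTranspose = p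
  generalize onSite x (spinRaise (d x)).conjTranspose * onSite y (spinRaise (d y)) = q
  simp only [add_mul, sub_mul, mul_add, mul_sub, smul_mul_assoc, mul_smul_comm, one_mul, mul_one]
  module

/-- A vector of maximal spin is killed by `bond * bondᴴ`, hence by `bondᴴ`, so it is orthogonal to
the range of `bond`. -/
theorem starProjection_maxSpinSpace_bond {x y : Λ} (h : x ≠ y) (χ : Conf d Λ → ℂ) :
    (maxSpinSpace d Λ x y).starProjection (WithLp.toLp 2 ((bond d Λ x y).mulVec χ)) = 0 := by
  rw [Submodule.starProjection_apply_eq_zero_iff, Submodule.mem_orthogonal]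
  intro φ hφ
  rw [maxSpinSpace, Module.End.mem_eigenspace_iff] at hφ
  have h1 : (bond d Λ x y * (bond d Λ x y).conjTranspose).mulVec φ.ofLp = 0 := by
    have := congrArg WithLp.ofLp hφ
    rw [Matrix.ofLp_toLpLin, Matrix.toLin'_apply] at this
    rw [bond_mul_conjTranspose h, Matrix.sub_mulVec, this, Matrix.smul_mulVec, Matrix.one_mulVec]
    simp
  have h2 : (bond d Λ x y).conjTranspose.mulVec φ.ofLp = 0 := by
    rw [← Matrix.self_mul_conjTranspose_mulVec_eq_zero]
    exact h1
  rw [EuclideanSpace.inner_eq_star_dotProduct, dotProduct_comm, Matrix.dotProduct_mulVec]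
  have h3 := congrArg star h2
  rw [Matrix.star_mulVec, Matrix.conjTranspose_conjTranspose] at h3
  rw [h3, star_zero, zero_dotProduct]

end Region

/-! ### Partial traces -/

section Reduce

variable {V : Type*} [DecidableEq V] {d : V → ℕ} {Λ Λ' : Finset V}

/-- The configuration on `Λ'` that is `σ` on `Λ` and `ξ` elsewhere. -/
def glue (σ : Conf d Λ) (ξ : Conf d (Λ' \ Λ)) : Conf d Λ' := fun y =>
  if hy : (y : V) ∈ Λ then σ ⟨y, hy⟩ else ξ ⟨y, Finset.mem_sdiff.2 ⟨y.2, hy⟩⟩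

theorem glue_of_mem (σ : Conf d Λ) (ξ : Conf d (Λ' \ Λ)) (y : Λ') (hy : (y : V) ∈ Λ) :
    glue σ ξ y = σ ⟨y, hy⟩ := dif_pos hy

theorem glue_of_notMem (σ : Conf d Λ) (ξ : Conf d (Λ' \ Λ)) (y : Λ') (hy : (y : V) ∉ Λ) :
    glue σ ξ y = ξ ⟨y, Finset.mem_sdiff.2 ⟨y.2, hy⟩⟩ := dif_neg hy

theorem glue_left (σ : Conf d Λ) (ξ : Conf d (Λ' \ Λ)) (x : Λ) (hx : (x : V) ∈ Λ') :
    glue σ ξ ⟨x, hx⟩ = σ x := dif_pos x.2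

theorem glue_right (σ : Conf d Λ) (ξ : Conf d (Λ' \ Λ)) (x : (Λ' \ Λ : Finset V))
    (hx : (x : V) ∈ Λ') : glue σ ξ ⟨x, hx⟩ = ξ x := dif_neg (Finset.mem_sdiff.1 x.2).2

/-- Configurations on `Λ'` are pairs of configurations on `Λ` and on its complement. -/
def glueEquiv (d : V → ℕ) (h : Λ ⊆ Λ') : Conf d Λ × Conf d (Λ' \ Λ) ≃ Conf d Λ' where
  toFun p := glue p.1 p.2
  invFun σ := (fun x => σ ⟨x, h x.2⟩, fun x => σ ⟨x, (Finset.mem_sdiff.1 x.2).1⟩)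
  left_inv := by
    rintro ⟨σ, ξ⟩
    exact Prod.ext (funext fun x => glue_left σ ξ x (h x.2))
      (funext fun x => glue_right σ ξ x (Finset.mem_sdiff.1 x.2).1)
  right_inv := by
    intro σ
    ext y
    by_cases hy : (y : V) ∈ Λ
    · simp [glue_of_mem _ _ _ hy]
    · simp [glue_of_notMem _ _ _ hy]

theorem sum_glue (h : Λ ⊆ Λ') {M : Type*} [AddCommMonoid M] (f : Conf d Λ' → M) :
    ∑ σ, f σ = ∑ σ : Conf d Λ, ∑ ξ : Conf d (Λ' \ Λ), f (glue σ ξ) := by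
  rw [← Fintype.sum_prod_type', ← (glueEquiv d h).sum_comp]
  rfl

/-- The partial trace of `ρ` over the sites outside `Λ`. -/
def reduce (Λ : Finset V) (ρ : Obs d Λ') : Obs d Λ :=
  Matrix.of fun σ τ => ∑ ξ : Conf d (Λ' \ Λ), ρ (glue σ ξ) (glue τ ξ)

theorem extend_glue (h : Λ ⊆ Λ') (A : Obs d Λ) (σ τ : Conf d Λ) (ξ η : Conf d (Λ' \ Λ)) :
    extend h A (glue σ ξ) (glue τ η) = if ξ = η then A σ τ else 0 := by
  have h1 : (∀ y : Λ', (y : V) ∉ Λ → glue σ ξ y = glue τ η y) ↔ ξ = η := by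
    constructor
    · intro H
      funext x
      have hx := Finset.mem_sdiff.1 x.2
      exact (glue_right σ ξ x hx.1).symm.trans
        ((H ⟨x, hx.1⟩ hx.2).trans (glue_right τ η x hx.1))
    · rintro rfl y hy
      rw [glue_of_notMem _ _ _ hy, glue_of_notMem _ _ _ hy]
  simp only [extend, Matrix.of_apply, h1]
  congr 2 <;> ext x <;> simp [glue_of_mem]

theorem trace_reduce_mul (h : Λ ⊆ Λ') (ρ : Obs d Λ') (A : Obs d Λ) :
    (reduce Λ ρ * A).trace = (ρ * extend h A).trace := by
  simp only [Matrix.trace, Matrix.diag_apply, Matrix.mul_apply]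
  rw [sum_glue h]
  refine Finset.sum_congr rfl fun σ _ => ?_
  simp only [sum_glue h, extend_glue, mul_ite, mul_zero, Finset.sum_ite_eq', Finset.mem_univ,
    if_true, reduce, Matrix.of_apply, Finset.sum_mul]
  rw [Finset.sum_comm]

theorem extend_extend {Λ₀ : Finset V} (h₀ : Λ₀ ⊆ Λ) (h : Λ ⊆ Λ') (A : Obs d Λ₀) :
    extend h (extend h₀ A) = extend (h₀.trans h) A := by
  ext σ τ
  simp only [extend, Matrix.of_apply, ← ite_and]
  congr 1
  rw [eq_iff_iff]
  constructor
  · rintro ⟨h1, h2⟩ y hy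
    by_cases hy' : (y : V) ∈ Λ
    · exact h2 ⟨y, hy'⟩ hy
    · exact h1 y hy'
  · intro H
    exact ⟨fun y hy => H y fun hy' => hy (h₀ hy'), fun y hy => H ⟨y, h y.2⟩ hy⟩

theorem expectation_reduce {Λ₀ : Finset V} (h₀ : Λ₀ ⊆ Λ) (h : Λ ⊆ Λ') (ρ : Obs d Λ')
    (A : Obs d Λ₀) : expectation (reduce Λ ρ) Λ₀ A = expectation ρ Λ₀ A := by
  rw [expectation, expectation, dif_pos h₀, dif_pos (h₀.trans h), trace_reduce_mul h,
    extend_extend]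

theorem trace_reduce (h : Λ ⊆ Λ') (ρ : Obs d Λ') : (reduce Λ ρ).trace = ρ.trace := by
  simp only [Matrix.trace, Matrix.diag_apply]
  rw [sum_glue h]
  rfl

/-- The vector of the values of `ψ` at the configurations that are `ξ` outside `Λ`. -/
def slice (ψ : Conf d Λ' → ℂ) (ξ : Conf d (Λ' \ Λ)) : Conf d Λ → ℂ := fun σ => ψ (glue σ ξ)

/-- The partial trace of a pure state is the mixture of its slices, so its range is controlled slice
by slice. -/
theorem reduce_vecMulVec (ψ : Conf d Λ' → ℂ) :
    reduce Λ (Matrix.vecMulVec ψ (star ψ)) =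
      ∑ ξ : Conf d (Λ' \ Λ), Matrix.vecMulVec (slice ψ ξ) (star (slice ψ ξ)) := by
  ext σ τ
  simp [reduce, slice, Matrix.vecMulVec_apply, Matrix.sum_apply]

theorem glue_update (x : Λ) (h : (x : V) ∈ Λ') (σ : Conf d Λ) (ξ : Conf d (Λ' \ Λ))
    (j : Fin (d x + 1)) :
    glue (Function.update σ x j) ξ =
      Function.update (glue σ ξ : Conf d Λ') (⟨x, h⟩ : Λ') j := by
  ext y
  by_cases hy : (y : V) ∈ Λ
  · rw [glue_of_mem _ _ _ hy]
    by_cases hyx : y = ⟨x, h⟩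
    · subst hyx; simp
    · have : (⟨y, hy⟩ : Λ) ≠ x := fun e => hyx (Subtype.ext (congrArg (fun z : Λ => (z : V)) e))
      rw [Function.update_of_ne this, Function.update_of_ne hyx, glue_of_mem _ _ _ hy]
  · have hyx : y ≠ ⟨x, h⟩ := fun e => hy (by rw [e]; exact x.2)
    rw [glue_of_notMem _ _ _ hy, Function.update_of_ne hyx, glue_of_notMem _ _ _ hy]

theorem slice_onSite (x : Λ) (h : (x : V) ∈ Λ') (M : Matrix (Fin (d x + 1)) (Fin (d x + 1)) ℂ)
    (χ : Conf d Λ' → ℂ) (ξ : Conf d (Λ' \ Λ)) :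
    slice ((onSite (d := d) (⟨x, h⟩ : Λ') M).mulVec χ) ξ
      = (onSite x M).mulVec (slice χ ξ) := by
  ext σ
  rw [onSite_mulVec]
  refine (onSite_mulVec _ _ _ _).trans (Finset.sum_congr rfl fun j _ => ?_)
  exact congrArg₂ (· * ·) (congrArg (fun i => M i j) (glue_left σ ξ x h))
    (congrArg χ (glue_update x h σ ξ j).symm)

/-- A bond inside `Λ` acts without touching the frozen outside configuration; this is how bonds pass
to slices. -/
theorem slice_bond (x y : Λ) (hx : (x : V) ∈ Λ') (hy : (y : V) ∈ Λ')
    (χ : Conf d Λ' → ℂ) (ξ : Conf d (Λ' \ Λ)) :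
    slice ((bond d Λ' ⟨x, hx⟩ ⟨y, hy⟩).mulVec χ) ξ = (bond d Λ x y).mulVec (slice χ ξ) := by
  rw [bond, bond, Matrix.sub_mulVec, Matrix.sub_mulVec, ← Matrix.mulVec_mulVec,
    ← Matrix.mulVec_mulVec, ← Matrix.mulVec_mulVec, ← Matrix.mulVec_mulVec,
    ← slice_onSite y hy, ← slice_onSite y hy, ← slice_onSite x hx, ← slice_onSite x hx]
  rfl

end Reduce

/-! ### Ground states -/

section GroundState

variable {V : Type*} [DecidableEq V] (G : SimpleGraph V) [G.LocallyFinite]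

/-- The vector `ψ` contains a valence bond on every edge of the region `Λ`. -/
def IsBonded (Λ : Finset V) (ψ : Conf (fun v => G.degree v) Λ → ℂ) : Prop :=
  ∀ x y : Λ, G.Adj x y → ∃ χ, ψ = (bond (fun v => G.degree v) Λ x y).mulVec χ

variable {G}

theorem IsBonded.slice {Λ Λ' : Finset V} (h : Λ ⊆ Λ') {ψ : Conf (fun v => G.degree v) Λ' → ℂ}
    (hψ : IsBonded G Λ' ψ) (ξ : Conf (fun v => G.degree v) (Λ' \ Λ)) :
    IsBonded G Λ (slice ψ ξ) := by
  intro x y hxy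
  obtain ⟨χ, hχ⟩ := hψ ⟨x, h x.2⟩ ⟨y, h y.2⟩ hxy
  exact ⟨AKLT.slice χ ξ, by rw [hχ, slice_bond]⟩

theorem IsBonded.smul {Λ : Finset V} {ψ : Conf (fun v => G.degree v) Λ → ℂ}
    (hψ : IsBonded G Λ ψ) (c : ℂ) : IsBonded G Λ (c • ψ) := by
  intro x y hxy
  obtain ⟨χ, hχ⟩ := hψ x y hxy
  exact ⟨c • χ, by rw [hχ, Matrix.mulVec_smul]⟩

theorem IsBonded.hamiltonian_eq_zero [DecidableRel G.Adj] {Λ : Finset V} {ψ : Conf (fun v => G.degree v) Λ → ℂ}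
    (hψ : IsBonded G Λ ψ) : hamiltonian G Λ (WithLp.toLp 2 ψ) = 0 := by
  rw [hamiltonian, smul_apply, sum_apply,
    Finset.sum_eq_zero, smul_zero]
  intro x _
  rw [sum_apply, Finset.sum_eq_zero]
  intro y _
  split_ifs with hxy
  · obtain ⟨χ, hχ⟩ := hψ x y hxy
    rw [hχ]
    exact starProjection_maxSpinSpace_bond (fun e => hxy.ne (congrArg Subtype.val e)) χ
  · rfl

/-- Every slice still carries a bond on each inner edge, so the Hamiltonian annihilates the whole
range of the reduced matrix. -/
theorem isGroundState_reduce [DecidableRel G.Adj] {Λ Λ' : Finset V} (h : Λ ⊆ Λ')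
    {ψ : Conf (fun v => G.degree v) Λ' → ℂ} (hψ : IsBonded G Λ' ψ) (h1 : ψ ⬝ᵥ star ψ = 1) :
    IsGroundState G Λ (reduce Λ (Matrix.vecMulVec ψ (star ψ))) where
  posSemidef := by
    rw [reduce_vecMulVec]
    exact Matrix.posSemidef_sum _ fun ξ _ => Matrix.posSemidef_vecMulVec_self_star _
  trace_eq_one := by rw [trace_reduce h, Matrix.trace_vecMulVec, h1]
  hamiltonian_eq_zero := by
    intro φ
    rw [reduce_vecMulVec, map_sum, LinearMap.sum_apply, map_sum]
    refine Finset.sum_eq_zero fun ξ _ => ?_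
    have : Matrix.toEuclideanLin (Matrix.vecMulVec (slice ψ ξ) (star (slice ψ ξ))) φ =
        WithLp.toLp 2 ((star (slice ψ ξ) ⬝ᵥ φ.ofLp) • slice ψ ξ) := by
      apply WithLp.ofLp_injective
      rw [Matrix.ofLp_toLpLin, Matrix.toLin'_apply, Matrix.vecMulVec_mulVec]
      ext σ
      simp [mul_comm]
    rw [this]
    exact ((hψ.slice h ξ).smul _).hamiltonian_eq_zero

/-- The bound `2uv ≤ u² + v²` and normalization give an estimate independent of `Λ'`, which supplies
compactness. -/
theorem norm_reduce_apply_le {d : V → ℕ} {Λ Λ' : Finset V} (h : Λ ⊆ Λ') {ψ : Conf d Λ' → ℂ}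
    (h1 : ψ ⬝ᵥ star ψ = 1) (σ τ : Conf d Λ) :
    ‖reduce Λ (Matrix.vecMulVec ψ (star ψ)) σ τ‖ ≤ 1 := by
  have hsum : ∑ σ, ‖ψ σ‖ ^ 2 = 1 := by
    have : ((∑ σ, ‖ψ σ‖ ^ 2 : ℝ) : ℂ) = 1 := by
      rw [← h1, dotProduct]
      push_cast
      refine Finset.sum_congr rfl fun σ _ => ?_
      rw [Pi.star_apply, Complex.star_def, Complex.mul_conj, Complex.normSq_eq_norm_sq]
      push_cast; rfl
    exact_mod_cast this
  have hle : ∀ σ : Conf d Λ, ∑ ξ : Conf d (Λ' \ Λ), ‖ψ (glue σ ξ)‖ ^ 2 ≤ 1 := by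
    intro σ
    rw [← hsum, sum_glue h]
    exact Finset.single_le_sum
      (f := fun σ : Conf d Λ => ∑ ξ : Conf d (Λ' \ Λ), ‖ψ (glue σ ξ)‖ ^ 2)
      (fun i _ => Finset.sum_nonneg fun _ _ => by positivity) (Finset.mem_univ σ)
  calc ‖reduce Λ (Matrix.vecMulVec ψ (star ψ)) σ τ‖
      ≤ ∑ ξ : Conf d (Λ' \ Λ), ‖ψ (glue σ ξ)‖ * ‖ψ (glue τ ξ)‖ := by
        refine (norm_sum_le _ _).trans (Finset.sum_le_sum fun ξ _ => ?_)
        simp [Matrix.vecMulVec_apply]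
    _ ≤ ∑ ξ : Conf d (Λ' \ Λ), (‖ψ (glue σ ξ)‖ ^ 2 + ‖ψ (glue τ ξ)‖ ^ 2) / 2 := by
        refine Finset.sum_le_sum fun ξ _ => ?_
        nlinarith [sq_nonneg (‖ψ (glue σ ξ)‖ - ‖ψ (glue τ ξ)‖)]
    _ ≤ 1 := by
        rw [← Finset.sum_div, Finset.sum_add_distrib]
        linarith [hle σ, hle τ]

theorem IsGroundState.of_tendsto [DecidableRel G.Adj] {Λ : Finset V} {ι : Type*} {l : Filter ι} [l.NeBot]
    {ρ : ι → Obs (fun v => G.degree v) Λ} {ρ₀ : Obs (fun v => G.degree v) Λ}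
    (h : Tendsto ρ l (𝓝 ρ₀)) (hρ : ∀ᶠ i in l, IsGroundState G Λ (ρ i)) :
    IsGroundState G Λ ρ₀ where
  posSemidef := by
    refine Matrix.PosSemidef.of_dotProduct_mulVec_nonneg ?_ fun x => ?_
    · have h1 : Tendsto (fun i => (ρ i).conjTranspose) l (𝓝 ρ₀.conjTranspose) :=
        ((continuous_id.matrix_conjTranspose).tendsto ρ₀).comp h
      exact tendsto_nhds_unique
        (h1.congr' (hρ.mono fun i hi => hi.posSemidef.isHermitian)) h
    · have h1 : Tendsto (fun i => star x ⬝ᵥ (ρ i).mulVec x) l (𝓝 (star x ⬝ᵥ ρ₀.mulVec x)) :=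
        ((continuous_const.dotProduct
          (continuous_id.matrix_mulVec continuous_const)).tendsto ρ₀).comp h
      exact ge_of_tendsto h1 (hρ.mono fun i hi => hi.posSemidef.dotProduct_mulVec_nonneg x)
  trace_eq_one := by
    have h1 : Tendsto (fun i => (ρ i).trace) l (𝓝 ρ₀.trace) :=
      ((continuous_id.matrix_trace).tendsto ρ₀).comp h
    exact tendsto_nhds_unique (h1.congr' (hρ.mono fun i hi => hi.trace_eq_one))
      tendsto_const_nhds
  hamiltonian_eq_zero := by
    intro φ
    have hc : Continuous fun A : Obs (fun v => G.degree v) Λ =>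
        hamiltonian G Λ (Matrix.toEuclideanLin A φ) :=
      (hamiltonian G Λ).continuous.comp ((PiLp.continuous_toLp 2 _).comp
        (continuous_id.matrix_mulVec continuous_const))
    exact tendsto_nhds_unique
      (((hc.tendsto ρ₀).comp h).congr' (hρ.mono fun i hi => hi.hamiltonian_eq_zero φ))
      tendsto_const_nhds

variable (G) in
theorem ball_mono (o : V) : Monotone (ball G o) :=
  monotone_nat_of_le_succ fun _ => Finset.subset_union_left

theorem exists_subset_ball (hG : G.Connected) (o : V) (Λ : Finset V) :
    ∃ n, Λ ⊆ ball G o n := by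
  refine ⟨Λ.sup (G.dist o), fun x hx => ?_⟩
  rw [mem_ball G hG]
  exact Finset.le_sup (f := G.dist o) hx

theorem continuous_expectation {d : V → ℕ} {Λ' : Finset V} (Λ : Finset V) (A : Obs d Λ) :
    Continuous fun ρ : Obs d Λ' => expectation ρ Λ A := by
  unfold expectation
  split_ifs
  · exact (continuous_id.matrix_mul continuous_const).matrix_trace
  · exact continuous_const

/-- Every sequence of normalized valence bond states on the balls has an infinite-volume ground
state as a cluster point. -/
theorem exists_infiniteVolumeGroundState [DecidableRel G.Adj] (hG : G.Connected) (o : V)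
    (ψ : ∀ n, Conf (fun v => G.degree v) (ball G o n) → ℂ)
    (hψ : ∀ n, IsBonded G (ball G o n) (ψ n)) (h1 : ∀ n, ψ n ⬝ᵥ star (ψ n) = 1) :
    ∃ ω ∈ infiniteVolumeGroundStates G o, ∀ Λ A,
      Tendsto (fun n => expectation (Matrix.vecMulVec (ψ n) (star (ψ n))) Λ A)
        (hyperfilter ℕ : Filter ℕ) (𝓝 (ω Λ A)) := by
  set P : ∀ n, Obs (fun v => G.degree v) (ball G o n) :=
    fun n => Matrix.vecMulVec (ψ n) (star (ψ n)) with hP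
  have hge : ∀ n, ∀ᶠ m in (hyperfilter ℕ : Filter ℕ), n ≤ m := fun n =>
    Nat.hyperfilter_le_atTop (eventually_ge_atTop n)
  -- The entries lie in the unit disc once `m ≥ n`, so they converge along the ultrafilter. One
  -- ultrafilter serves all `n`, in place of a diagonal subsequence.
  have hR : ∀ n, ∃ R : Obs (fun v => G.degree v) (ball G o n),
      Tendsto (fun m => reduce (ball G o n) (P m)) (hyperfilter ℕ : Filter ℕ) (𝓝 R) := by
    intro n
    have : ∀ σ τ, ∃ r : ℂ, Tendsto (fun m => reduce (ball G o n) (P m) σ τ)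
        (hyperfilter ℕ : Filter ℕ) (𝓝 r) := by
      intro σ τ
      obtain ⟨r, -, hr⟩ := (isCompact_closedBall (0 : ℂ) 1).ultrafilter_le_nhds
        ((hyperfilter ℕ).map fun m => reduce (ball G o n) (P m) σ τ) (by
          rw [le_principal_iff]
          refine (hge n).mono fun m hm => ?_
          simpa using norm_reduce_apply_le (ball_mono G o hm) (h1 m) σ τ)
      exact ⟨r, hr⟩
    choose r hr using this
    exact ⟨Matrix.of r, tendsto_pi_nhds.2 fun σ => tendsto_pi_nhds.2 fun τ => hr σ τ⟩
  choose R hR using hR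
  have key : ∀ Λ (A : Obs (fun v => G.degree v) Λ) n, Λ ⊆ ball G o n →
      Tendsto (fun m => expectation (P m) Λ A) (hyperfilter ℕ : Filter ℕ)
        (𝓝 (expectation (R n) Λ A)) := by
    intro Λ A n hn
    refine (((continuous_expectation Λ A).tendsto (R n)).comp (hR n)).congr' ?_
    exact (hge n).mono fun m hm => expectation_reduce hn (ball_mono G o hm) _ _
  have hω : ∀ Λ (A : Obs (fun v => G.degree v) Λ), ∃ w,
      Tendsto (fun m => expectation (P m) Λ A) (hyperfilter ℕ : Filter ℕ) (𝓝 w) := by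
    intro Λ A
    obtain ⟨n, hn⟩ := exists_subset_ball hG o Λ
    exact ⟨_, key Λ A n hn⟩
  choose ω hω using hω
  -- The limits `R n` themselves form the required sequence of finite-volume ground states: they are
  -- consistent, so the expectation of a local observable is constant once the ball contains its
  -- support. This gives convergence along `atTop`.
  refine ⟨ω, ⟨R, fun n => ?_, fun Λ A => ?_⟩, hω⟩
  · exact IsGroundState.of_tendsto (hR n) ((hge n).mono fun m hm =>
      isGroundState_reduce (ball_mono G o hm) (hψ m) (h1 m))
  · obtain ⟨n, hn⟩ := exists_subset_ball hG o Λ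
    refine tendsto_const_nhds.congr' ?_
    filter_upwards [eventually_ge_atTop n] with m hm
    exact tendsto_nhds_unique (hω Λ A) (key Λ A m (hn.trans (ball_mono G o hm)))

end GroundState

/-! ### Products of affine functions -/

section Affine

variable {ι : Type*}

/-- Induction: `(1 + a)(1 + 2X)` exceeds `(1 + 2(a + X))(1 - a)` by `4aX + 2a²`. It bounds the odd
part of `∏ (1 + β s)` from below. -/
theorem prod_one_sub_le (I : Finset ι) (x : ι → ℝ) (h0 : ∀ i ∈ I, 0 ≤ x i)
    (h1 : ∀ i ∈ I, x i ≤ 1) :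
    (1 + 2 * ∑ i ∈ I, x i) * ∏ i ∈ I, (1 - x i) ≤ ∏ i ∈ I, (1 + x i) := by
  classical
  induction I using Finset.induction_on with
  | empty => simp
  | insert a I ha ih =>
    have ih := ih (fun i hi => h0 i (Finset.mem_insert_of_mem hi))
      (fun i hi => h1 i (Finset.mem_insert_of_mem hi))
    have ha0 := h0 a (Finset.mem_insert_self a I)
    have ha1 := h1 a (Finset.mem_insert_self a I)
    rw [Finset.prod_insert ha, Finset.prod_insert ha, Finset.sum_insert ha]
    have hB : 0 ≤ ∏ i ∈ I, (1 - x i) :=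
      Finset.prod_nonneg fun i hi => by linarith [h1 i (Finset.mem_insert_of_mem hi)]
    have hX : 0 ≤ ∑ i ∈ I, x i :=
      Finset.sum_nonneg fun i hi => h0 i (Finset.mem_insert_of_mem hi)
    set X := ∑ i ∈ I, x i
    set A := ∏ i ∈ I, (1 + x i)
    set B := ∏ i ∈ I, (1 - x i)
    have h2 : (1 + 2 * (x a + X)) * (1 - x a) ≤ (1 + x a) * (1 + 2 * X) := by
      nlinarith [mul_nonneg ha0 hX, sq_nonneg (x a)]
    calc (1 + 2 * (x a + X)) * ((1 - x a) * B) = (1 + 2 * (x a + X)) * (1 - x a) * B := by ring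
      _ ≤ (1 + x a) * (1 + 2 * X) * B := mul_le_mul_of_nonneg_right h2 hB
      _ = (1 + x a) * ((1 + 2 * X) * B) := by ring
      _ ≤ (1 + x a) * A := mul_le_mul_of_nonneg_left ih (by linarith)

/-- The even and odd parts must be treated together: a new factor adds `β s` times the odd part to
the even one and conversely. Both are polynomials in `s` with nonnegative coefficients. -/
theorem prod_affine_even_odd_mono (I : Finset ι) (β : ι → ℝ) (h0 : ∀ i ∈ I, 0 ≤ β i)
    {s s' : ℝ} (hs : 0 ≤ s) (hss' : s ≤ s') :
    (0 ≤ ∏ i ∈ I, (1 + β i * s) + ∏ i ∈ I, (1 - β i * s) ∧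
      ∏ i ∈ I, (1 + β i * s) + ∏ i ∈ I, (1 - β i * s) ≤
        ∏ i ∈ I, (1 + β i * s') + ∏ i ∈ I, (1 - β i * s')) ∧
    (0 ≤ ∏ i ∈ I, (1 + β i * s) - ∏ i ∈ I, (1 - β i * s) ∧
      ∏ i ∈ I, (1 + β i * s) - ∏ i ∈ I, (1 - β i * s) ≤
        ∏ i ∈ I, (1 + β i * s') - ∏ i ∈ I, (1 - β i * s')) := by
  classical
  induction I using Finset.induction_on with
  | empty => simp
  | insert a I ha ih =>
    obtain ⟨⟨e0, e1⟩, o0, o1⟩ := ih fun i hi => h0 i (Finset.mem_insert_of_mem hi)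
    have ha0 := h0 a (Finset.mem_insert_self a I)
    simp only [Finset.prod_insert ha]
    set A := ∏ i ∈ I, (1 + β i * s)
    set B := ∏ i ∈ I, (1 - β i * s)
    set A' := ∏ i ∈ I, (1 + β i * s')
    set B' := ∏ i ∈ I, (1 - β i * s')
    have m1 : 0 ≤ β a * s := mul_nonneg ha0 hs
    have m2 : β a * s ≤ β a * s' := mul_le_mul_of_nonneg_left hss' ha0
    have m3 : 0 ≤ β a * s * (A - B) := mul_nonneg m1 o0
    have m4 : 0 ≤ β a * s * (A + B) := mul_nonneg m1 e0
    have m5 : β a * s * (A - B) ≤ β a * s' * (A' - B') := mul_le_mul m2 o1 o0 (m1.trans m2)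
    have m6 : β a * s * (A + B) ≤ β a * s' * (A' + B') := mul_le_mul m2 e1 e0 (m1.trans m2)
    refine ⟨⟨?_, ?_⟩, ?_, ?_⟩ <;> nlinarith

theorem integral_zero_one_eq_symm (g : ℝ → ℝ) (hg : Continuous g) :
    ∫ t in (0 : ℝ)..1, g (2 * t - 1) = 1 / 2 * ∫ s in (0 : ℝ)..1, (g s + g (-s)) := by
  have h1 := intervalIntegral.integral_comp_mul_sub (a := 0) (b := 1) g (two_ne_zero (α := ℝ)) 1
  rw [h1]
  norm_num
  rw [← intervalIntegral.integral_add_adjacent_intervals (b := 0)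
    (hg.intervalIntegrable _ _) (hg.intervalIntegrable _ _),
    intervalIntegral.integral_add (hg.intervalIntegrable _ _)
      (Continuous.intervalIntegrable (by fun_prop) _ _),
    intervalIntegral.integral_comp_neg (a := 0) (b := 1) g, neg_zero]
  ring

/-- The moments of a product of affine functions on `[0, 1]`: the first moment of `2 t - 1` is
bounded from below by the sum of the slopes. -/
theorem integral_prod_affine_le (I : Finset ι) (β : ι → ℝ) (h0 : ∀ i ∈ I, 0 ≤ β i)
    (h1 : ∀ i ∈ I, β i ≤ 1) :
    (∑ i ∈ I, β i) * ∫ t in (0 : ℝ)..1, ∏ i ∈ I, (1 + β i * (2 * t - 1)) ≤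
      3 * (1 + ∑ i ∈ I, β i) *
        ∫ t in (0 : ℝ)..1, (2 * t - 1) * ∏ i ∈ I, (1 + β i * (2 * t - 1)) := by
  set S := ∑ i ∈ I, β i with hS
  have hS0 : 0 ≤ S := Finset.sum_nonneg h0
  set W : ℝ → ℝ := fun s => ∏ i ∈ I, (1 + β i * s) with hW
  have hWc : Continuous W := by fun_prop
  set E : ℝ → ℝ := fun s => W s + W (-s) with hE
  have hEc : Continuous E := by fun_prop
  have hWneg : ∀ s, W (-s) = ∏ i ∈ I, (1 - β i * s) := fun s => by
    simp only [hW, mul_neg, ← sub_eq_add_neg]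
  have hD := integral_zero_one_eq_symm W hWc
  have hN := integral_zero_one_eq_symm (fun s => s * W s) (by fun_prop)
  simp only [hW] at hD hN
  rw [hD, hN]
  change S * (1 / 2 * ∫ s in (0 : ℝ)..1, E s) ≤
    3 * (1 + S) * (1 / 2 * ∫ s in (0 : ℝ)..1, (s * W s + -s * W (-s)))
  -- `prod_one_sub_le` at `β s` compares the odd part with the even part; `S s ≤ S` then frees the
  -- factor `1 + S` from `s`.
  have hodd : ∀ s ∈ Set.Icc (0 : ℝ) 1, S * (s ^ 2 * E s) ≤ (1 + S) * (s * W s + -s * W (-s)) := by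
    rintro s ⟨hs0, hs1⟩
    have k1 := prod_one_sub_le I (fun i => β i * s) (fun i hi => mul_nonneg (h0 i hi) hs0)
      (fun i hi => mul_le_one₀ (h1 i hi) hs0 hs1)
    rw [← Finset.sum_mul, ← hWneg] at k1
    have k2 := (prod_affine_even_odd_mono I β h0 hs0 le_rfl).2.1
    rw [← hWneg] at k2
    change (1 + 2 * (S * s)) * W (-s) ≤ W s at k1
    change 0 ≤ W s - W (-s) at k2
    have k3 : S * s * (W s + W (-s)) ≤ (1 + S) * (W s - W (-s)) := by
      nlinarith [mul_nonneg (mul_nonneg hS0 (sub_nonneg.2 hs1)) k2]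
    have k4 := mul_le_mul_of_nonneg_left k3 hs0
    simp only [hE]
    linarith
  -- Chebyshev's integral inequality: `s²` and `E` both increase, and `1/3` is the mean of `s²`.
  -- Replacing `E s` by its value at `s² = 1/3` only lowers the integrand.
  have hcheb : 0 ≤ ∫ s in (0 : ℝ)..1, (s ^ 2 - 1 / 3) * E s := by
    set c : ℝ := Real.sqrt (1 / 3) with hc
    have hc0 : 0 ≤ c := Real.sqrt_nonneg _
    have hc2 : c ^ 2 = 1 / 3 := Real.sq_sqrt (by norm_num)
    have hmono : ∀ {s s'}, 0 ≤ s → s ≤ s' → E s ≤ E s' := by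
      intro s s' hs hss'
      simp only [hE, hWneg]
      exact (prod_affine_even_odd_mono I β h0 hs hss').1.2
    have hz : ∫ s in (0 : ℝ)..1, (s ^ 2 - 1 / 3) * E c = 0 := by
      rw [intervalIntegral.integral_mul_const, intervalIntegral.integral_sub
        (by apply Continuous.intervalIntegrable; fun_prop) (by simp), integral_pow]
      norm_num
    refine hz.symm.trans_le ?_
    apply intervalIntegral.integral_mono_on zero_le_one
    · apply Continuous.intervalIntegrable; fun_prop
    · apply Continuous.intervalIntegrable; fun_prop
    · rintro s ⟨hs0, -⟩
      rw [← hc2]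
      rcases le_total s c with h | h
      · have : s ^ 2 ≤ c ^ 2 := by gcongr
        nlinarith [hmono hs0 h]
      · have : c ^ 2 ≤ s ^ 2 := by gcongr
        nlinarith [hmono hc0 h]
  have hint := intervalIntegral.integral_mono_on (μ := MeasureTheory.volume) (a := 0) (b := 1)
    zero_le_one (by apply Continuous.intervalIntegrable; fun_prop)
    (by apply Continuous.intervalIntegrable; fun_prop) hodd
  rw [intervalIntegral.integral_const_mul, intervalIntegral.integral_const_mul] at hint
  have hsplit : ∫ s in (0 : ℝ)..1, (s ^ 2 - 1 / 3) * E s =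
      (∫ s in (0 : ℝ)..1, s ^ 2 * E s) - 1 / 3 * ∫ s in (0 : ℝ)..1, E s := by
    rw [← intervalIntegral.integral_const_mul, ← intervalIntegral.integral_sub]
    · congr 1; ext s; ring
    · apply Continuous.intervalIntegrable; fun_prop
    · apply Continuous.intervalIntegrable; fun_prop
  rw [hsplit] at hcheb
  nlinarith [mul_nonneg hS0 hcheb]

theorem affine_nonneg {β t : ℝ} (h0 : 0 ≤ β) (h1 : β ≤ 1) (ht : t ∈ Set.Icc (0 : ℝ) 1) :
    0 ≤ 1 + β * (2 * t - 1) := by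
  nlinarith [ht.1, ht.2]

theorem integral_prod_affine_pos (I : Finset ι) (β : ι → ℝ) (h0 : ∀ i ∈ I, 0 ≤ β i)
    (h1 : ∀ i ∈ I, β i ≤ 1) : 0 < ∫ t in (0 : ℝ)..1, ∏ i ∈ I, (1 + β i * (2 * t - 1)) := by
  apply intervalIntegral.intervalIntegral_pos_of_pos_on
  · apply Continuous.intervalIntegrable; fun_prop
  · rintro t ⟨ht0, ht1⟩
    refine Finset.prod_pos fun i hi => ?_
    nlinarith [h0 i hi, h1 i hi, mul_nonneg (h0 i hi) ht0.le]
  · exact zero_lt_one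

theorem integral_prod_affine_abs (I : Finset ι) (β : ι → ℝ) (h0 : ∀ i ∈ I, 0 ≤ β i)
    (h1 : ∀ i ∈ I, β i ≤ 1) :
    ∫ t in (0 : ℝ)..1, (2 * t - 1) * ∏ i ∈ I, (1 + β i * (2 * t - 1)) ≤
      ∫ t in (0 : ℝ)..1, ∏ i ∈ I, (1 + β i * (2 * t - 1)) := by
  apply intervalIntegral.integral_mono_on zero_le_one
  · apply Continuous.intervalIntegrable; fun_prop
  · apply Continuous.intervalIntegrable; fun_prop
  · intro t ht
    have : 0 ≤ ∏ i ∈ I, (1 + β i * (2 * t - 1)) :=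
      Finset.prod_nonneg fun i hi => affine_nonneg (h0 i hi) (h1 i hi) ht
    nlinarith [ht.2]

end Affine

/-! ### Beta integrals -/

section Beta

/-- The weight of the occupation number `k` for `d` bosons. -/
def occ (d k : ℕ) : ℝ := ∫ t in (0 : ℝ)..1, t ^ k * (1 - t) ^ (d - k)

theorem occ_pos (d k : ℕ) : 0 < occ d k := by
  apply intervalIntegral.intervalIntegral_pos_of_pos_on
  · apply Continuous.intervalIntegrable; fun_prop
  · rintro t ⟨ht0, ht1⟩
    have : 0 < 1 - t := by linarith
    positivity
  · exact zero_lt_one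

/-- Integrate the derivative of `t^(k+1) (1-t)^(d-k)`, which vanishes at both ends. -/
theorem occ_succ {d k : ℕ} (h : k < d) : ((d : ℝ) - k) * occ d (k + 1) = (k + 1) * occ d k := by
  obtain ⟨m, rfl⟩ : ∃ m, d = k + m + 1 := ⟨d - k - 1, by omega⟩
  have e1 : k + m + 1 - (k + 1) = m := by omega
  have e2 : k + m + 1 - k = m + 1 := by omega
  have hd : ∀ t : ℝ, HasDerivAt (fun t : ℝ => t ^ (k + 1) * (1 - t) ^ (m + 1))
      (((k : ℝ) + 1) * (t ^ k * (1 - t) ^ (m + 1))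
        - ((m : ℝ) + 1) * (t ^ (k + 1) * (1 - t) ^ m)) t := by
    intro t
    have a := hasDerivAt_pow (k + 1) t
    have b := ((hasDerivAt_id t).const_sub 1).pow (m + 1)
    refine (a.mul b).congr_deriv ?_
    simp
    ring
  have hi := intervalIntegral.integral_eq_sub_of_hasDerivAt (a := 0) (b := 1)
    (fun t _ => hd t) (by apply Continuous.intervalIntegrable; fun_prop)
  rw [intervalIntegral.integral_sub (by apply Continuous.intervalIntegrable; fun_prop)
    (by apply Continuous.intervalIntegrable; fun_prop), intervalIntegral.integral_const_mul,
    intervalIntegral.integral_const_mul] at hi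
  simp only [occ, e1, e2]
  push_cast
  norm_num at hi
  linarith

/-- Split `2t - 1 = t - (1 - t)` and `1 = t + (1 - t)` into the two weights for `d + 1`, whose ratio
is known from `occ_succ`. This turns the spin `k - d/2` into an insertion of `2t - 1`. -/
theorem integral_mul_occ {d k : ℕ} (h : k ≤ d) :
    ∫ t in (0 : ℝ)..1, (2 * t - 1) * (t ^ k * (1 - t) ^ (d - k)) =
      (2 / ((d : ℝ) + 2)) * (((k : ℝ) - d / 2) * occ d k) := by
  have e1 : d + 1 - (k + 1) = d - k := by omega
  have e2 : d + 1 - k = d - k + 1 := by omega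
  have h1 := occ_succ (d := d + 1) (k := k) (by omega)
  have h2 : ∫ t in (0 : ℝ)..1, (2 * t - 1) * (t ^ k * (1 - t) ^ (d - k)) =
      occ (d + 1) (k + 1) - occ (d + 1) k := by
    rw [occ, occ, ← intervalIntegral.integral_sub, e1, e2]
    · congr 1; ext t; ring
    · apply Continuous.intervalIntegrable; fun_prop
    · apply Continuous.intervalIntegrable; fun_prop
  have h3 : occ d k = occ (d + 1) (k + 1) + occ (d + 1) k := by
    rw [occ, occ, occ, ← intervalIntegral.integral_add, e1, e2]
    · congr 1; ext t; ring
    · apply Continuous.intervalIntegrable; fun_prop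
    · apply Continuous.intervalIntegrable; fun_prop
  rw [h2, h3]
  push_cast at h1
  have : ((d : ℝ) + 2) ≠ 0 := by positivity
  field_simp
  linarith

end Beta

/-! ### Rooted trees -/

section Tree

variable {V : Type*} (G : SimpleGraph V) [G.LocallyFinite] (o : V)

/-- The children of the vertex `x` of the tree `G` with the root `o`. -/
def children (x : V) : Finset V :=
  (G.neighborFinset x).filter fun y => G.dist o y = G.dist o x + 1

variable {G o}

theorem mem_children {x y : V} : y ∈ children G o x ↔ G.Adj x y ∧ G.dist o y = G.dist o x + 1 := by
  simp [children]

/-- Shortest walks through either parent are paths from the root to `x`, and a tree has only one. -/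
theorem children_unique (hG : G.IsTree) {x y z : V} (hy : x ∈ children G o y)
    (hz : x ∈ children G o z) : y = z := by
  rw [mem_children] at hy hz
  obtain ⟨p, hp⟩ := hG.connected.exists_walk_length_eq_dist o y
  obtain ⟨q, hq⟩ := hG.connected.exists_walk_length_eq_dist o z
  have h1 := (p.concat hy.1).isPath_of_length_eq_dist (by simp [hp, hy.2])
  have h2 := (q.concat hz.1).isPath_of_length_eq_dist (by simp [hq, hz.2])
  have h3 := congrArg Subtype.val ((hG.isAcyclic.subsingleton_path o x).elim ⟨_, h1⟩ ⟨_, h2⟩)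
  obtain ⟨h, -⟩ := SimpleGraph.Walk.concat_inj h3
  exact h

theorem mem_children_or (hG : G.IsTree) {x y : V} (h : G.Adj x y) :
    y ∈ children G o x ∨ x ∈ children G o y := by
  rw [mem_children, mem_children]
  rcases hG.dist_eq_dist_add_one_of_adj o h with h' | h'
  · exact Or.inr ⟨h.symm, h'⟩
  · exact Or.inl ⟨h, h'⟩

theorem exists_mem_children (hG : G.IsTree) {x : V} (hx : x ≠ o) : ∃ y, x ∈ children G o y := by
  obtain ⟨p, hp⟩ := hG.connected.exists_walk_length_eq_dist x o
  cases p with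
  | nil => exact absurd rfl hx
  | cons hadj q =>
    rename_i y
    refine ⟨y, mem_children.2 ⟨hadj.symm, ?_⟩⟩
    have h1 := SimpleGraph.dist_le q
    rw [SimpleGraph.Walk.length_cons, SimpleGraph.dist_comm] at hp
    rw [SimpleGraph.dist_comm] at h1
    rcases hG.dist_eq_dist_add_one_of_adj o hadj with h | h <;> omega

theorem ne_root_of_mem_children {x y : V} (h : x ∈ children G o y) : x ≠ o := by
  rintro rfl
  simp [mem_children] at h

theorem card_children_root : (children G o o).card = G.degree o := by
  rw [children, Finset.filter_true_of_mem, SimpleGraph.card_neighborFinset_eq_degree]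
  intro y hy
  rw [SimpleGraph.mem_neighborFinset] at hy
  rw [SimpleGraph.dist_self, SimpleGraph.dist_eq_one_iff_adj.2 hy]

theorem card_children (hG : G.IsTree) {x : V} (hx : x ≠ o) :
    (children G o x).card + 1 = G.degree x := by
  classical
  obtain ⟨p, hp⟩ := exists_mem_children hG hx
  have hp' := mem_children.1 hp
  have hnot : p ∉ children G o x := by
    rw [mem_children]
    omega
  rw [← SimpleGraph.card_neighborFinset_eq_degree, ← Finset.card_insert_of_notMem hnot]
  congr 1
  ext y
  rw [Finset.mem_insert, SimpleGraph.mem_neighborFinset]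
  constructor
  · rintro (rfl | h)
    · exact hp'.1.symm
    · exact (mem_children.1 h).1
  · intro h
    rcases mem_children_or (o := o) hG h with h' | h'
    · exact Or.inr h'
    · exact Or.inl (children_unique hG h' hp)

theorem children_nonempty [Infinite V] (hG : G.IsTree) (hleaf : ∀ v, G.degree v ≠ 1) (x : V) :
    (children G o x).Nonempty := by
  rw [← Finset.card_pos]
  have hpos : 0 < G.degree x := hG.connected.preconnected.degree_pos_of_nontrivial x
  by_cases hx : x = o
  · subst hx
    rwa [card_children_root]
  · have := card_children hG hx
    have := hleaf x
    omega

end Tree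

/-! ### Messages and their recursion -/

section Message

variable {V : Type*} (G : SimpleGraph V) [G.LocallyFinite] (o : V)

/-- The message that the vertex `y` sends to its parent when the tree is cut `k` levels below
`y`. -/
def message : ℕ → V → ℝ → ℝ
  | 0, _ => fun t => t
  | k + 1, y => fun t =>
      t * (∫ s in (0 : ℝ)..1, s * ∏ z ∈ children G o y, message k z s)
        + (1 - t) * ∫ s in (0 : ℝ)..1, (1 - s) * ∏ z ∈ children G o y, message k z s

theorem continuous_message (k : ℕ) (y : V) : Continuous (message G o k y) := by
  cases k <;> simp only [message] <;> fun_prop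

/-- `f` is, up to a positive factor, affine with a slope in `(0, 1]` of inverse at most `b`. -/
def IsTilted (f : ℝ → ℝ) (b : ℝ) : Prop :=
  ∃ a β : ℝ, 0 < a ∧ 0 < β ∧ β ≤ 1 ∧ β⁻¹ ≤ b ∧ ∀ t, f t = a * (1 + β * (2 * t - 1))

/-- The positive prefactors cancel between the two moments, and the slopes sum to at least `card /
b`, so `1/S ≤ b / card` in the bound `3 + 3/S`. -/
theorem IsTilted.prod {ι : Type*} {I : Finset ι} (hI : I.Nonempty) {f : ι → ℝ → ℝ} {b : ℝ}
    (hf : ∀ i ∈ I, IsTilted (f i) b) :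
    0 < (∫ t in (0 : ℝ)..1, ∏ i ∈ I, f i t) ∧
    0 < (∫ t in (0 : ℝ)..1, (2 * t - 1) * ∏ i ∈ I, f i t) ∧
    (∫ t in (0 : ℝ)..1, (2 * t - 1) * ∏ i ∈ I, f i t) ≤ (∫ t in (0 : ℝ)..1, ∏ i ∈ I, f i t) ∧
    (∫ t in (0 : ℝ)..1, ∏ i ∈ I, f i t) ≤
      (3 + 3 * b / I.card) * ∫ t in (0 : ℝ)..1, (2 * t - 1) * ∏ i ∈ I, f i t := by
  classical
  -- The parameters are made total in `i`, with irrelevant zeros outside `I`, so that they can be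
  -- chosen as functions.
  have hf' : ∀ i, ∃ a β : ℝ, i ∈ I → 0 < a ∧ 0 < β ∧ β ≤ 1 ∧ β⁻¹ ≤ b ∧
      ∀ t, f i t = a * (1 + β * (2 * t - 1)) := by
    intro i
    by_cases hi : i ∈ I
    · obtain ⟨a, β, h⟩ := hf i hi
      exact ⟨a, β, fun _ => h⟩
    · exact ⟨0, 0, fun h => absurd h hi⟩
  choose a β h using hf'
  have h0 : ∀ i ∈ I, 0 ≤ β i := fun i hi => (h i hi).2.1.le
  have h1 : ∀ i ∈ I, β i ≤ 1 := fun i hi => (h i hi).2.2.1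
  have ha : 0 < ∏ i ∈ I, a i := Finset.prod_pos fun i hi => (h i hi).1
  have hQ : ∀ t, ∏ i ∈ I, f i t = (∏ i ∈ I, a i) * ∏ i ∈ I, (1 + β i * (2 * t - 1)) := by
    intro t
    rw [← Finset.prod_mul_distrib]
    exact Finset.prod_congr rfl fun i hi => (h i hi).2.2.2.2 t
  have hQ' : ∀ t, (2 * t - 1) * ∏ i ∈ I, f i t =
      (∏ i ∈ I, a i) * ((2 * t - 1) * ∏ i ∈ I, (1 + β i * (2 * t - 1))) := by
    intro t
    rw [hQ]; ring
  have iD : ∫ t in (0 : ℝ)..1, ∏ i ∈ I, f i t = (∏ i ∈ I, a i) *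
      ∫ t in (0 : ℝ)..1, ∏ i ∈ I, (1 + β i * (2 * t - 1)) := by
    simp only [hQ, intervalIntegral.integral_const_mul]
  have iN : ∫ t in (0 : ℝ)..1, (2 * t - 1) * ∏ i ∈ I, f i t = (∏ i ∈ I, a i) *
      ∫ t in (0 : ℝ)..1, (2 * t - 1) * ∏ i ∈ I, (1 + β i * (2 * t - 1)) := by
    rw [← intervalIntegral.integral_const_mul]
    simp only [hQ']
  rw [iD, iN]
  have hD := integral_prod_affine_pos I β h0 h1
  have hND := integral_prod_affine_abs I β h0 h1
  have hlow := integral_prod_affine_le I β h0 h1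
  set D := ∫ t in (0 : ℝ)..1, ∏ i ∈ I, (1 + β i * (2 * t - 1))
  set N := ∫ t in (0 : ℝ)..1, (2 * t - 1) * ∏ i ∈ I, (1 + β i * (2 * t - 1))
  set S := ∑ i ∈ I, β i with hS
  have hm : (0 : ℝ) < I.card := by exact_mod_cast hI.card_pos
  have hb : 0 < b := by
    obtain ⟨i, hi⟩ := hI
    exact (inv_pos.2 (h i hi).2.1).trans_le (h i hi).2.2.2.1
  have hSm : (I.card : ℝ) / b ≤ S := by
    rw [div_eq_mul_inv, ← nsmul_eq_mul]
    refine Finset.card_nsmul_le_sum _ _ _ fun i hi => ?_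
    exact inv_le_of_inv_le₀ (h i hi).2.1 (h i hi).2.2.2.1
  have hS0 : 0 < S := (div_pos hm hb).trans_le hSm
  have hN : 0 < N := by
    have : 0 < 3 * (1 + S) * N := (mul_pos hS0 hD).trans_le hlow
    exact (pos_iff_pos_of_mul_pos this).1 (by positivity)
  refine ⟨mul_pos ha hD, mul_pos ha hN, mul_le_mul_of_nonneg_left hND ha.le, ?_⟩
  have h2 : D ≤ (3 + 3 * b / I.card) * N := by
    have h3 : 1 / S ≤ b / I.card := by
      rw [div_le_div_iff₀ hS0 hm]
      rw [div_le_iff₀ hb] at hSm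
      linarith
    have h4 : D ≤ (3 + 3 * (1 / S)) * N := by
      have : (3 + 3 * (1 / S)) * N = 3 * (1 + S) * N / S := by field_simp; ring
      rw [this, le_div_iff₀ hS0]
      linarith
    refine h4.trans (mul_le_mul_of_nonneg_right ?_ hN.le)
    rw [mul_div_assoc]
    linarith
  calc (∏ i ∈ I, a i) * D ≤ (∏ i ∈ I, a i) * ((3 + 3 * b / I.card) * N) :=
        mul_le_mul_of_nonneg_left h2 ha.le
    _ = _ := by ring

/-- With the moments `D` of `1` and `N` of `2s - 1`, the outgoing message is `(D + N (2t - 1)) / 2`,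
so the new slope is `N / D`. -/
theorem isTilted_message_succ {k : ℕ} {y : V} {b : ℝ} (hy : (children G o y).Nonempty)
    (h : ∀ z ∈ children G o y, IsTilted (message G o k z) b) :
    IsTilted (message G o (k + 1) y) (3 + 3 * b / (children G o y).card) := by
  obtain ⟨hD, hN, hND, hlow⟩ := IsTilted.prod hy h
  have hc : Continuous fun s => ∏ z ∈ children G o y, message G o k z s :=
    continuous_finsetProd _ fun z _ => continuous_message G o k z
  simp only [IsTilted, message]
  generalize (children G o y).card = m at *
  generalize hQ : (fun s => ∏ z ∈ children G o y, message G o k z s) = Q at hc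
  have hQ' : ∀ s, ∏ z ∈ children G o y, message G o k z s = Q s := fun s => congrFun hQ s
  simp only [hQ'] at *
  set D := ∫ s in (0 : ℝ)..1, Q s
  set N := ∫ s in (0 : ℝ)..1, (2 * s - 1) * Q s
  have i1 : ∫ s in (0 : ℝ)..1, s * Q s = (D + N) / 2 := by
    rw [← intervalIntegral.integral_add (Continuous.intervalIntegrable (by fun_prop) _ _)
      (Continuous.intervalIntegrable (by fun_prop) _ _), ← intervalIntegral.integral_div]
    congr 1; ext s; ring
  have i2 : ∫ s in (0 : ℝ)..1, (1 - s) * Q s = (D - N) / 2 := by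
    rw [← intervalIntegral.integral_sub (Continuous.intervalIntegrable (by fun_prop) _ _)
      (Continuous.intervalIntegrable (by fun_prop) _ _), ← intervalIntegral.integral_div]
    congr 1; ext s; ring
  rw [i1, i2]
  refine ⟨D / 2, N / D, by positivity, div_pos hN hD, (div_le_one hD).2 hND, ?_, fun t => ?_⟩
  · rw [inv_div, div_le_iff₀ hN]
    exact hlow
  · field_simp
    ring

/-- The first `ℓ` steps of `p` lead from the root away from it. -/
def IsDescending (p : ℕ → V) (ℓ : ℕ) : Prop :=
  p 0 = o ∧ ∀ k < ℓ, p (k + 1) ∈ children G o (p k)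

variable {G o}

theorem IsDescending.update [DecidableEq V] {p : ℕ → V} {ℓ : ℕ} (hp : IsDescending G o p ℓ)
    {z : V} (hz : z ∈ children G o (p ℓ)) :
    IsDescending G o (Function.update p (ℓ + 1) z) (ℓ + 1) := by
  refine ⟨by rw [Function.update_of_ne (by omega), hp.1], fun k hk => ?_⟩
  rw [Function.update_of_ne (a := k) (by omega)]
  rcases Nat.lt_succ_iff_lt_or_eq.1 hk with h | rfl
  · rw [Function.update_of_ne (by omega)]
    exact hp.2 k h
  · rwa [Function.update_self]

variable [Infinite V]

theorem IsDescending.le_prod (hG : G.IsTree) (hleaf : ∀ v : V, G.degree v ≠ 1) {μ C : ℝ}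
    (hpath : ∀ p : ℕ → V, p 0 = o → (∀ k, G.Adj (p k) (p (k + 1))) →
      (∀ k, G.dist o (p k) = k) →
      ∀ n : ℕ, C * μ ^ n ≤ ∏ k ∈ Finset.Icc 1 n, ((G.degree (p k) : ℝ) - 1) / 3)
    {p : ℕ → V} {ℓ : ℕ} (hp : IsDescending G o p ℓ) :
    C * μ ^ ℓ ≤ ∏ k ∈ Finset.Icc 1 ℓ, ((G.degree (p k) : ℝ) - 1) / 3 := by
  choose c hc using fun x => children_nonempty (o := o) hG hleaf x
  set q : ℕ → V := fun k => if k ≤ ℓ then p k else c^[k - ℓ] (p ℓ) with hq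
  have hstep : ∀ k, q (k + 1) ∈ children G o (q k) := by
    intro k
    rcases lt_trichotomy k ℓ with h | h | h
    · simp only [hq, if_pos h.le, if_pos (Nat.succ_le_of_lt h)]
      exact hp.2 k h
    · subst h
      simp [hq, hc]
    · simp only [hq, if_neg (show ¬ k ≤ ℓ by omega), if_neg (show ¬ k + 1 ≤ ℓ by omega)]
      rw [show k + 1 - ℓ = (k - ℓ) + 1 by omega, Function.iterate_succ_apply']
      exact hc _
  have hq0 : q 0 = o := by simp [hq, hp.1]
  have hdist : ∀ k, G.dist o (q k) = k := by
    intro k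
    induction k with
    | zero => simp [hq0]
    | succ k ih => rw [(mem_children.1 (hstep k)).2, ih]
  refine (hpath q hq0 (fun k => (mem_children.1 (hstep k)).1) hdist ℓ).trans_eq ?_
  refine Finset.prod_congr rfl fun k hk => ?_
  rw [show q k = p k from if_pos (Finset.mem_Icc.1 hk).2]

/-- The bound `b_ℓ = K μ^(-ℓ) ∏ (deg - 1)/3` is a supersolution of `b ↦ 3 + 3 b / m`: one step back
gives `3 + b_ℓ / μ`, and `3 ≤ b_ℓ (1 - 1/μ)` by the growth hypothesis and the choice of `K`. It does
not depend on the cutting level `k`. -/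
theorem isTilted_message [DecidableEq V] (hG : G.IsTree) (hleaf : ∀ v : V, G.degree v ≠ 1)
    {μ C : ℝ} (hμ : 1 < μ) (hC : 0 < C)
    (hpath : ∀ p : ℕ → V, p 0 = o → (∀ k, G.Adj (p k) (p (k + 1))) →
      (∀ k, G.dist o (p k) = k) →
      ∀ n : ℕ, C * μ ^ n ≤ ∏ k ∈ Finset.Icc 1 n, ((G.degree (p k) : ℝ) - 1) / 3)
    (k : ℕ) (p : ℕ → V) (ℓ : ℕ) (hp : IsDescending G o p (ℓ + 1)) :
    IsTilted (message G o k (p (ℓ + 1)))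
      (3 / (C * (1 - μ⁻¹)) / μ ^ ℓ * ∏ j ∈ Finset.Icc 1 ℓ, ((G.degree (p j) : ℝ) - 1) / 3) := by
  have hμ0 : 0 < μ := by linarith
  have hμi : 0 < 1 - μ⁻¹ := by
    have := inv_lt_one_of_one_lt₀ hμ
    linarith
  have hμi' : 1 - μ⁻¹ ≤ 1 := by
    have := inv_pos.2 hμ0
    linarith
  have hlow : ∀ (p : ℕ → V) (ℓ : ℕ), IsDescending G o p (ℓ + 1) → 3 ≤
      3 / (C * (1 - μ⁻¹)) / μ ^ ℓ * (∏ j ∈ Finset.Icc 1 ℓ, ((G.degree (p j) : ℝ) - 1) / 3)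
        * (1 - μ⁻¹) := by
    intro p ℓ hp
    have hp' : IsDescending G o p ℓ := ⟨hp.1, fun k hk => hp.2 k (by omega)⟩
    have h1 := hp'.le_prod hG hleaf hpath
    calc (3 : ℝ) = 3 / (C * (1 - μ⁻¹)) / μ ^ ℓ * (C * μ ^ ℓ) * (1 - μ⁻¹) := by
          generalize 1 - μ⁻¹ = r at *
          field_simp
      _ ≤ _ := by gcongr
  induction k generalizing p ℓ with
  | zero =>
    refine ⟨1 / 2, 1, by norm_num, one_pos, le_rfl, ?_, fun t => ?_⟩
    swap
    · simp [message]
    have := hlow p ℓ hp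
    rw [inv_one]
    nlinarith
  | succ k ih =>
    set b := 3 / (C * (1 - μ⁻¹)) / μ ^ (ℓ + 1) *
      ∏ j ∈ Finset.Icc 1 (ℓ + 1), ((G.degree (p j) : ℝ) - 1) / 3 with hb
    have hz : ∀ z ∈ children G o (p (ℓ + 1)), IsTilted (message G o k z) b := by
      intro z hz
      have := ih _ _ (hp.update hz)
      rw [Function.update_self] at this
      convert this using 2
      refine Finset.prod_congr rfl fun j hj => ?_
      rw [Function.update_of_ne]
      have := (Finset.mem_Icc.1 hj).2
      omega
    have hne := children_nonempty (o := o) hG hleaf (p (ℓ + 1))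
    obtain ⟨a, β, ha, hβ, hβ1, hβb, hf⟩ := isTilted_message_succ G o hne hz
    refine ⟨a, β, ha, hβ, hβ1, hβb.trans ?_, hf⟩
    have hcard : ((G.degree (p (ℓ + 1)) : ℝ) - 1) = (children G o (p (ℓ + 1))).card := by
      rw [← card_children hG (ne_root_of_mem_children (hp.2 ℓ (by omega)))]
      push_cast; ring
    have hm : (0 : ℝ) < (children G o (p (ℓ + 1))).card := by exact_mod_cast hne.card_pos
    rw [hb, Finset.prod_Icc_succ_top (by omega), hcard]
    have := hlow p ℓ hp
    set m : ℝ := ((children G o (p (ℓ + 1))).card : ℝ)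
    set P := ∏ j ∈ Finset.Icc 1 ℓ, ((G.degree (p j) : ℝ) - 1) / 3
    set K := 3 / (C * (1 - μ⁻¹))
    -- The last factor `m / 3` of the longer product cancels the recursion factor `3 / m`.
    have e : 3 * (K / μ ^ (ℓ + 1) * (P * (m / 3))) / m = K / μ ^ ℓ * P * μ⁻¹ := by
      field_simp
      ring
    rw [e]
    linarith

end Message

/-! ### Summation over the edges of a finite tree -/

section Partition

variable {V : Type*} [DecidableEq V] (G : SimpleGraph V) [G.LocallyFinite] (o : V)

/-- The factor at one end of the edge above `y` when `S` is the set of the marked edges (an edge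
is labelled by its lower end). -/
def edgeFactor (S : Finset V) (y : V) (t : ℝ) : ℝ := if y ∈ S then t else 1 - t

theorem continuous_edgeFactor (S : Finset V) (y : V) : Continuous (edgeFactor S y) := by
  unfold edgeFactor
  split_ifs <;> fun_prop

/-- The factor of the edge above `x`, or of the observable `φ` if `x` is the root. -/
def upFactor (φ : ℝ → ℝ) (S : Finset V) (x : V) : ℝ → ℝ :=
  if x = o then φ else edgeFactor S x

/-- The factor of the edge above `y`, or the message `msg y` if `y` is outside the region `B`. -/
def downFactor (B : Finset V) (msg : V → ℝ → ℝ) (S : Finset V) (y : V) : ℝ → ℝ :=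
  if y ∈ B then edgeFactor S y else msg y

/-- The weight of the vertex `x` of the region `B`. -/
def vertexWeight (B : Finset V) (msg : V → ℝ → ℝ) (φ : ℝ → ℝ) (S : Finset V) (x : V) : ℝ :=
  ∫ t in (0 : ℝ)..1, upFactor o φ S x t * ∏ y ∈ children G o x, downFactor B msg S y t

/-- The partition function of the region `B` with the messages `msg` from the outside. -/
def partition (B : Finset V) (msg : V → ℝ → ℝ) (φ : ℝ → ℝ) : ℝ :=
  ∑ S ∈ (B.erase o).powerset, ∏ x ∈ B, vertexWeight G o B msg φ S x

variable {G o}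

/-- Peel off `x`, none of whose children are in `B`: summing over the mark of the edge above `x` and
integrating out `x` leaves at the parent exactly the message of `x`. All other weights are
unchanged. -/
theorem partition_erase (hG : G.IsTree) {B : Finset V} {msg : V → ℝ → ℝ} {φ : ℝ → ℝ}
    (hmsg : ∀ y, Continuous (msg y)) (hφ : Continuous φ) {x p : V} (hx : x ∈ B) (hp : p ∈ B)
    (hxp : x ∈ children G o p) (hch : ∀ y ∈ children G o x, y ∉ B)
    (hrec : ∀ t, msg x t =
      t * (∫ s in (0 : ℝ)..1, s * ∏ z ∈ children G o x, msg z s)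
        + (1 - t) * ∫ s in (0 : ℝ)..1, (1 - s) * ∏ z ∈ children G o x, msg z s) :
    partition G o B msg φ = partition G o (B.erase x) msg φ := by
  have hxo : x ≠ o := ne_root_of_mem_children hxp
  have hpx : p ≠ x := by
    rintro rfl
    simp [mem_children] at hxp
  set B' := B.erase x with hB'
  have hpB' : p ∈ B' := Finset.mem_erase.2 ⟨hpx, hp⟩
  have hBx : B = insert x B' := (Finset.insert_erase hx).symm
  have hxB' : x ∉ B' := Finset.notMem_erase x B
  have hBo : B.erase o = insert x (B'.erase o) := by
    rw [hB', Finset.erase_right_comm, Finset.insert_erase (Finset.mem_erase.2 ⟨hxo, hx⟩)]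
  have hxBo : x ∉ B'.erase o := fun h => hxB' (Finset.mem_of_mem_erase h)
  have hmem : ∀ {y}, y ≠ x → (y ∈ B ↔ y ∈ B') := fun {y} hy => by simp [hB', hy]
  rw [partition, hBo, Finset.sum_powerset_insert hxBo, ← Finset.sum_add_distrib, partition]
  refine Finset.sum_congr rfl fun S hS => ?_
  have hxS : x ∉ S := fun h => hxBo (Finset.mem_powerset.1 hS h)
  have hself : ∀ T, vertexWeight G o B msg φ T x =
      ∫ s in (0 : ℝ)..1, edgeFactor T x s * ∏ z ∈ children G o x, msg z s := by
    intro T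
    rw [vertexWeight, upFactor, if_neg hxo]
    congr 1
    ext s
    congr 1
    exact Finset.prod_congr rfl fun y hy => by rw [downFactor, if_neg (hch y hy)]
  have hother : ∀ T, (∀ y, y ≠ x → (y ∈ T ↔ y ∈ S)) → ∀ z ∈ B'.erase p,
      vertexWeight G o B msg φ T z = vertexWeight G o B' msg φ S z := by
    intro T hT z hz
    have hzp : z ≠ p := Finset.ne_of_mem_erase hz
    have hzx : z ≠ x := fun h => hxB' (h ▸ Finset.mem_of_mem_erase hz)
    have hup : upFactor o φ T z = upFactor o φ S z := by
      unfold upFactor edgeFactor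
      simp only [hT z hzx]
    rw [vertexWeight, vertexWeight, hup]
    congr 1
    ext s
    congr 1
    refine Finset.prod_congr rfl fun y hy => ?_
    have hyx : y ≠ x := by
      rintro rfl
      exact hzp (children_unique hG hy hxp)
    unfold downFactor edgeFactor
    simp only [hT y hyx, hmem hyx]
  set R : ℝ → ℝ := fun s => upFactor o φ S p s *
    ∏ y ∈ (children G o p).erase x, downFactor B' msg S y s with hR
  have hRc : Continuous R := by
    have hup : Continuous (upFactor o φ S p) := by
      unfold upFactor
      split_ifs
      · exact hφ
      · exact continuous_edgeFactor S p
    refine hup.mul (continuous_finsetProd _ fun y _ => ?_)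
    unfold downFactor
    split_ifs
    · exact continuous_edgeFactor S y
    · exact hmsg y
  have hparent : ∀ T, (∀ y, y ≠ x → (y ∈ T ↔ y ∈ S)) →
      vertexWeight G o B msg φ T p = ∫ s in (0 : ℝ)..1, R s * edgeFactor T x s := by
    intro T hT
    have hup : upFactor o φ T p = upFactor o φ S p := by
      unfold upFactor edgeFactor
      simp only [hT p hpx]
    rw [vertexWeight, hup]
    congr 1
    ext s
    rw [hR, ← Finset.mul_prod_erase _ _ hxp, mul_comm (downFactor B msg T x s), ← mul_assoc]
    congr 1
    · congr 1
      refine Finset.prod_congr rfl fun y hy => ?_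
      have hyx : y ≠ x := Finset.ne_of_mem_erase hy
      unfold downFactor edgeFactor
      simp only [hT y hyx, hmem hyx]
    · rw [downFactor, if_pos hx]
  have hparent' : vertexWeight G o B' msg φ S p = ∫ s in (0 : ℝ)..1, R s * msg x s := by
    rw [vertexWeight]
    congr 1
    ext s
    rw [hR, ← Finset.mul_prod_erase _ _ hxp, mul_comm (downFactor B' msg S x s), ← mul_assoc]
    congr 1
    rw [downFactor, if_neg hxB']
  have hins : ∀ y, y ≠ x → (y ∈ insert x S ↔ y ∈ S) := fun y hy => by simp [hy]
  have hfac : ∀ f : V → ℝ, ∏ z ∈ B, f z = f x * (f p * ∏ z ∈ B'.erase p, f z) := by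
    intro f
    rw [hBx, Finset.prod_insert hxB', ← Finset.mul_prod_erase _ _ hpB']
  rw [hfac, hfac, Finset.prod_congr rfl (hother S fun _ _ => Iff.rfl),
    Finset.prod_congr rfl (hother _ hins), hself, hself, hparent S fun _ _ => Iff.rfl,
    hparent _ hins, ← Finset.mul_prod_erase _ _ hpB', hparent']
  have e1 : edgeFactor (insert x S) x = fun s => s := by
    funext s; simp [edgeFactor]
  have e2 : edgeFactor S x = fun s => 1 - s := by
    funext s; simp [edgeFactor, hxS]
  rw [e1, e2]
  have hsplit : ∫ s in (0 : ℝ)..1, R s * msg x s =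
      (∫ s in (0 : ℝ)..1, s * ∏ z ∈ children G o x, msg z s) * (∫ s in (0 : ℝ)..1, R s * s)
      + (∫ s in (0 : ℝ)..1, (1 - s) * ∏ z ∈ children G o x, msg z s) *
        (∫ s in (0 : ℝ)..1, R s * (1 - s)) := by
    rw [← intervalIntegral.integral_const_mul, ← intervalIntegral.integral_const_mul,
      ← intervalIntegral.integral_add]
    · congr 1
      ext s
      rw [hrec]
      ring
    · apply Continuous.intervalIntegrable; fun_prop
    · apply Continuous.intervalIntegrable; fun_prop
  rw [hsplit]
  ring

/-- The sum over all the edges of a finite tree reduces to an integral at the root. -/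
theorem partition_eq (hG : G.IsTree) {msg : V → ℝ → ℝ} {φ : ℝ → ℝ}
    (hmsg : ∀ y, Continuous (msg y)) (hφ : Continuous φ) (B : Finset V) (ho : o ∈ B)
    (hclosed : ∀ x p, x ∈ B → x ∈ children G o p → p ∈ B)
    (hrec : ∀ x ∈ B, x ≠ o → ∀ t, msg x t =
      t * (∫ s in (0 : ℝ)..1, s * ∏ z ∈ children G o x, msg z s)
        + (1 - t) * ∫ s in (0 : ℝ)..1, (1 - s) * ∏ z ∈ children G o x, msg z s) :
    partition G o B msg φ = ∫ t in (0 : ℝ)..1, φ t * ∏ y ∈ children G o o, msg y t := by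
  induction hn : B.card generalizing B with
  | zero => simp [Finset.card_eq_zero.1 hn] at ho
  | succ n ih =>
    by_cases hB : (B.erase o).Nonempty
    -- A vertex of maximal depth has no children in `B`, so it can be peeled off.
    · obtain ⟨x, hx, hmax⟩ := Finset.exists_max_image _ (G.dist o) hB
      have hxo := Finset.ne_of_mem_erase hx
      have hxB := Finset.mem_of_mem_erase hx
      obtain ⟨p, hxp⟩ := exists_mem_children hG hxo
      have hch : ∀ y ∈ children G o x, y ∉ B := by
        intro y hy hyB
        have h1 := hmax y (Finset.mem_erase.2 ⟨ne_root_of_mem_children hy, hyB⟩)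
        have h2 := (mem_children.1 hy).2
        omega
      rw [partition_erase hG hmsg hφ hxB (hclosed x p hxB hxp) hxp hch (hrec x hxB hxo)]
      refine ih _ (Finset.mem_erase.2 ⟨hxo.symm, ho⟩) ?_ ?_ ?_
      · intro y q hy hyq
        refine Finset.mem_erase.2 ⟨?_, hclosed y q (Finset.mem_of_mem_erase hy) hyq⟩
        rintro rfl
        exact hch y hyq (Finset.mem_of_mem_erase hy)
      · exact fun y hy => hrec y (Finset.mem_of_mem_erase hy)
      · rw [Finset.card_erase_of_mem hxB, hn]; rfl
    · rw [Finset.not_nonempty_iff_eq_empty] at hB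
      have hBo : B = {o} := by
        rw [← Finset.insert_erase ho, hB]; rfl
      subst hBo
      rw [partition, hB, Finset.powerset_empty, Finset.sum_singleton, Finset.prod_singleton,
        vertexWeight, upFactor, if_pos rfl]
      congr 1
      ext s
      congr 1
      refine Finset.prod_congr rfl fun y hy => ?_
      rw [downFactor, if_neg]
      rw [Finset.mem_singleton]
      exact ne_root_of_mem_children hy

end Partition

/-! ### Valence bonds in the occupation number basis -/

section Single

variable {V : Type*} [DecidableEq V] {d : V → ℕ} {Λ : Finset V}

theorem onSite_create_mulVec_single (x : Λ) (σ τ : Conf d Λ)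
    (hx : (σ x : ℕ) = (τ x : ℕ) + 1) (hne : ∀ y, y ≠ x → σ y = τ y) :
    (onSite x (create (d x))).mulVec (Pi.single τ 1) =
      ((Real.sqrt ((τ x : ℕ) + 1) : ℝ) : ℂ) • Pi.single σ 1 := by
  rw [Matrix.mulVec_single_one]
  ext ξ
  simp only [Matrix.col_apply, onSite, create, lowerShift, Matrix.of_apply, Pi.smul_apply,
    smul_eq_mul]
  rw [← ite_and]
  by_cases h : ξ = σ
  · subst h
    rw [if_pos ⟨hne, hx⟩]
    simp
  · rw [if_neg, Pi.single_eq_of_ne h, mul_zero]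
    rintro ⟨h1, h2⟩
    refine h (funext fun y => ?_)
    by_cases hy : y = x
    · subst hy
      exact Fin.ext (h2.trans hx.symm)
    · rw [h1 y hy, hne y hy]

theorem onSite_createTwo_mulVec_single (x : Λ) (τ : Conf d Λ) :
    (onSite x (createTwo (d x))).mulVec (Pi.single τ 1) =
      ((Real.sqrt ((d x : ℝ) - (τ x : ℕ)) : ℝ) : ℂ) • Pi.single τ 1 := by
  rw [Matrix.mulVec_single_one]
  ext ξ
  simp only [Matrix.col_apply, onSite, createTwo, Matrix.of_apply, Pi.smul_apply, smul_eq_mul,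
    Matrix.diagonal_apply]
  rw [← ite_and]
  by_cases h : ξ = τ
  · subst h
    simp
  · rw [if_neg, Pi.single_eq_of_ne h, mul_zero]
    rintro ⟨h1, h2⟩
    refine h (funext fun y => ?_)
    by_cases hy : y = x
    · subst hy; exact h2
    · exact h1 y hy

theorem bond_mulVec_single {u v : Λ} (huv : u ≠ v) (σ σ' τ : Conf d Λ)
    (hu : (σ u : ℕ) = (τ u : ℕ) + 1) (hune : ∀ y, y ≠ u → σ y = τ y)
    (hv : (σ' v : ℕ) = (τ v : ℕ) + 1) (hvne : ∀ y, y ≠ v → σ' y = τ y) :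
    (bond d Λ u v).mulVec (Pi.single τ 1) =
      ((Real.sqrt ((τ u : ℕ) + 1) * Real.sqrt ((d v : ℝ) - (τ v : ℕ)) : ℝ) : ℂ) • Pi.single σ 1
      - ((Real.sqrt ((d u : ℝ) - (τ u : ℕ)) * Real.sqrt ((τ v : ℕ) + 1) : ℝ) : ℂ) •
        Pi.single σ' 1 := by
  rw [bond, Matrix.sub_mulVec, ← Matrix.mulVec_mulVec, ← Matrix.mulVec_mulVec,
    onSite_createTwo_mulVec_single, onSite_create_mulVec_single v σ' τ hv hvne,
    Matrix.mulVec_smul, Matrix.mulVec_smul, onSite_create_mulVec_single u σ τ hu hune,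
    onSite_createTwo_mulVec_single, hvne u huv, smul_smul, smul_smul]
  push_cast
  rw [mul_comm, mul_comm ((Real.sqrt ((τ v : ℕ) + 1) : ℝ) : ℂ)]

end Single

/-- The ratio of amplitudes that the matrix elements of the creation operators demand when one mark
is added. -/
theorem sqrt_occ_succ {d k : ℕ} (h : k < d) :
    Real.sqrt ((d : ℝ) - k) * Real.sqrt (occ d (k + 1)) =
      Real.sqrt ((k : ℝ) + 1) * Real.sqrt (occ d k) := by
  have : (k : ℝ) ≤ d := by exact_mod_cast h.le
  rw [← Real.sqrt_mul (by linarith), ← Real.sqrt_mul (by positivity), occ_succ h]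

/-! ### The valence bond states with a polarized boundary -/

section State

variable {V : Type*} [DecidableEq V] (G : SimpleGraph V) [G.LocallyFinite] (o : V)

/-- The number of marked edges at `x`, where the edges in `S` and those that leave the region `B`
downwards are marked. -/
def count (B S : Finset V) (x : V) : ℕ :=
  (if x ∈ S then 1 else 0) + ((children G o x).filter fun y => y ∈ B → y ∈ S).card

/-- The configuration with `count G o B S x` bosons at `x`, of the first kind if `c x` holds and of
the second kind otherwise. -/
def markedConf (B : Finset V) (c : V → Bool) (S : Finset V) : Conf (fun v => G.degree v) B :=
  -- The `min` only supplies the bound of the `Fin` type; it is inactive when `o ∉ S`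
  -- (`markedConf_val`).
  fun x => ⟨min (if c x then count G o B S x else G.degree x - count G o B S x) (G.degree x),
    Nat.lt_succ_of_le (min_le_right _ _)⟩

/-- The amplitude of the configuration with the set `S` of marked edges. -/
def amplitude (B S : Finset V) : ℝ :=
  (-1) ^ S.card * ∏ x ∈ B, Real.sqrt (occ (G.degree x) (count G o B S x))

/-- The valence bond state on the region `B` with a polarized boundary. -/
def bondState (B : Finset V) (c : V → Bool) : Conf (fun v => G.degree v) B → ℂ :=
  ∑ S ∈ (B.erase o).powerset, ((amplitude G o B S : ℝ) : ℂ) • Pi.single (markedConf G o B c S) 1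

variable {G o}

theorem count_le (hG : G.IsTree) {B S : Finset V} (hS : o ∉ S) (x : V) :
    count G o B S x ≤ G.degree x := by
  have h1 := Finset.card_filter_le (children G o x) fun y => y ∈ B → y ∈ S
  rw [count]
  by_cases hx : x = o
  · subst hx
    rw [if_neg hS, zero_add, ← card_children_root]
    exact h1
  · rw [← card_children hG hx]
    split_ifs <;> omega

theorem markedConf_val (hG : G.IsTree) {B S : Finset V} (hS : o ∉ S) (c : V → Bool) (x : B) :
    (markedConf G o B c S x : ℕ) =
      if c x then count G o B S x else G.degree x - count G o B S x := by
  have := count_le (B := B) hG hS x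
  simp only [markedConf]
  rw [min_eq_left]
  split_ifs <;> omega

theorem count_insert_self {B S : Finset V} {x : V} (hx : x ∉ S) :
    count G o B (insert x S) x = count G o B S x + 1 := by
  rw [count, count, if_pos (Finset.mem_insert_self x S), if_neg hx, zero_add, add_comm]
  congr 2
  refine Finset.filter_congr fun y hy => ?_
  have : y ≠ x := by
    rintro rfl
    simp [mem_children] at hy
  simp [this]

theorem count_insert_parent {B S : Finset V} {x p : V} (hxp : x ∈ children G o p) (hx : x ∉ S)
    (hxB : x ∈ B) : count G o B (insert x S) p = count G o B S p + 1 := by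
  have hpx : p ≠ x := by
    rintro rfl
    simp [mem_children] at hxp
  have : (children G o p).filter (fun y => y ∈ B → y ∈ insert x S) =
      insert x ((children G o p).filter fun y => y ∈ B → y ∈ S) := by
    ext y
    simp only [Finset.mem_filter, Finset.mem_insert]
    by_cases hy : y = x
    · subst hy; simp [hxp]
    · simp [hy]
  rw [count, count, this, Finset.card_insert_of_notMem (by simp [hx, hxB])]
  simp only [Finset.mem_insert, hpx, false_or]
  ring

theorem count_insert_of_ne (hG : G.IsTree) {B S : Finset V} {x p z : V}
    (hxp : x ∈ children G o p) (hzx : z ≠ x) (hzp : z ≠ p) :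
    count G o B (insert x S) z = count G o B S z := by
  rw [count, count]
  congr 1
  · simp [hzx]
  · congr 1
    refine Finset.filter_congr fun y hy => ?_
    have : y ≠ x := by
      rintro rfl
      exact hzp (children_unique hG hy hxp)
    simp [this]

/-- Two configurations that differ by the mark of one edge combine to a valence bond. -/
theorem exists_bond_eq_pair (hG : G.IsTree) {B S : Finset V} {c : V → Bool} {e : V} (u v : B)
    (huv : u ≠ v) (hS : o ∉ S) (heS : e ∉ S) (he : e ≠ o)
    (hcu : c u = true) (hcv : c v = false)
    (hu : count G o B (insert e S) u = count G o B S u + 1)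
    (hv : count G o B (insert e S) v = count G o B S v + 1)
    (hne : ∀ z, z ≠ (u : V) → z ≠ (v : V) → count G o B (insert e S) z = count G o B S z) :
    ∃ χ, ((amplitude G o B S : ℝ) : ℂ) • Pi.single (markedConf G o B c S) 1
      + ((amplitude G o B (insert e S) : ℝ) : ℂ) • Pi.single (markedConf G o B c (insert e S)) 1
      = (bond (fun v => G.degree v) B u v).mulVec χ := by
  have hS' : o ∉ insert e S := by simp [hS, he.symm]
  have hvu : (v : V) ≠ u := fun h => huv (Subtype.ext h.symm)
  have hku : count G o B S u < G.degree u := by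
    have := count_le (B := B) hG hS' u
    omega
  have hkv : count G o B S v < G.degree v := by
    have := count_le (B := B) hG hS' v
    omega
  have hku' : (0 : ℝ) < (G.degree u : ℝ) - (count G o B S u : ℕ) := by
    rw [sub_pos]; exact_mod_cast hku
  have hkv' : (0 : ℝ) < (G.degree v : ℝ) - (count G o B S v : ℕ) := by
    rw [sub_pos]; exact_mod_cast hkv
  set σ := markedConf G o B c (insert e S) with hσ
  set σ' := markedConf G o B c S with hσ'
  have hσne : ∀ z : B, z ≠ u → z ≠ v → σ z = σ' z := by
    intro z hzu hzv
    apply Fin.ext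
    rw [hσ, hσ', markedConf_val hG hS', markedConf_val hG hS,
      hne z (fun h => hzu (Subtype.ext h)) (fun h => hzv (Subtype.ext h))]
  have hσu : (σ u : ℕ) = count G o B S u + 1 := by
    rw [hσ, markedConf_val hG hS', if_pos hcu, hu]
  have hσu' : (σ' u : ℕ) = count G o B S u := by
    rw [hσ', markedConf_val hG hS, if_pos hcu]
  have hσv : (σ v : ℕ) = G.degree v - (count G o B S v + 1) := by
    rw [hσ, markedConf_val hG hS', hcv, hv]; simp
  have hσv' : (σ' v : ℕ) = G.degree v - count G o B S v := by
    rw [hσ', markedConf_val hG hS, hcv]; simp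
  -- The third configuration lacks the first-kind boson of the bond at both ends: creating it at `u`
  -- gives `σ`, at `v` gives `σ'`.
  have hb := bond_mulVec_single huv σ σ' (Function.update σ' v (σ v))
    (by rw [Function.update_of_ne huv, hσu, hσu'])
    (fun z hz => by
      by_cases hzv : z = v
      · subst hzv; simp
      · rw [Function.update_of_ne hzv, hσne z hz hzv])
    (by rw [Function.update_self, hσv, hσv']; omega)
    (fun z hz => by rw [Function.update_of_ne hz])
  rw [Function.update_of_ne huv, Function.update_self, hσu', hσv, Nat.cast_sub (by omega)] at hb
  have e1 : (G.degree v : ℝ) - ((G.degree v : ℝ) - ((count G o B S v + 1 : ℕ) : ℝ)) =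
      (count G o B S v : ℕ) + 1 := by push_cast; ring
  have e2 : (G.degree v : ℝ) - ((count G o B S v + 1 : ℕ) : ℝ) + 1 =
      (G.degree v : ℝ) - (count G o B S v : ℕ) := by push_cast; ring
  rw [e1, e2] at hb
  have hamp : Real.sqrt ((G.degree u : ℝ) - (count G o B S u : ℕ)) *
      Real.sqrt ((G.degree v : ℝ) - (count G o B S v : ℕ)) * amplitude G o B (insert e S) =
      -(Real.sqrt ((count G o B S u : ℕ) + 1) * Real.sqrt ((count G o B S v : ℕ) + 1) *
        amplitude G o B S) := by
    have hfac : ∀ f : V → ℝ, ∏ z ∈ B, f z = f u * (f v * ∏ z ∈ (B.erase u).erase v, f z) := by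
      intro f
      rw [Finset.mul_prod_erase _ _ (Finset.mem_erase.2 ⟨hvu, v.2⟩), Finset.mul_prod_erase _ _ u.2]
    have hrest : ∏ z ∈ (B.erase u).erase v,
          Real.sqrt (occ (G.degree z) (count G o B (insert e S) z)) =
        ∏ z ∈ (B.erase u).erase v, Real.sqrt (occ (G.degree z) (count G o B S z)) := by
      refine Finset.prod_congr rfl fun z hz => ?_
      rw [hne z (Finset.ne_of_mem_erase (Finset.mem_of_mem_erase hz)) (Finset.ne_of_mem_erase hz)]
    rw [amplitude, amplitude, hfac, hfac, hrest, hu, hv, Finset.card_insert_of_notMem heS, pow_succ]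
    have s1 := sqrt_occ_succ hku
    have s2 := sqrt_occ_succ hkv
    generalize ∏ z ∈ (B.erase u).erase v, Real.sqrt (occ (G.degree z) (count G o B S z)) = P
    calc _ = -((-1) ^ S.card * P *
        ((Real.sqrt ((G.degree u : ℝ) - (count G o B S u : ℕ)) *
          Real.sqrt (occ (G.degree u) (count G o B S u + 1))) *
        (Real.sqrt ((G.degree v : ℝ) - (count G o B S v : ℕ)) *
          Real.sqrt (occ (G.degree v) (count G o B S v + 1))))) := by ring
      _ = _ := by rw [s1, s2]; ring
  have hr : Real.sqrt ((G.degree u : ℝ) - (count G o B S u : ℕ)) *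
      Real.sqrt ((G.degree v : ℝ) - (count G o B S v : ℕ)) ≠ 0 :=
    (mul_pos (Real.sqrt_pos.2 hku') (Real.sqrt_pos.2 hkv')).ne'
  set r := Real.sqrt ((G.degree u : ℝ) - (count G o B S u : ℕ)) *
      Real.sqrt ((G.degree v : ℝ) - (count G o B S v : ℕ)) with hrdef
  set q := Real.sqrt ((count G o B S u : ℕ) + 1) * Real.sqrt ((count G o B S v : ℕ) + 1)
  -- The scalar is fixed by the coefficient `-r` of `σ'` in the bond; the coefficient `q` of `σ`
  -- then matches by `hamp`.
  refine ⟨(((-amplitude G o B S / r : ℝ)) : ℂ) • Pi.single (Function.update σ' v (σ v)) 1, ?_⟩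
  have f1 : -amplitude G o B S / r * q = amplitude G o B (insert e S) := by
    rw [div_mul_eq_mul_div, div_eq_iff hr]
    linarith
  have f2 : -amplitude G o B S / r * r = -amplitude G o B S := div_mul_cancel₀ _ hr
  rw [Matrix.mulVec_smul, hb, smul_sub, smul_smul, smul_smul, ← Complex.ofReal_mul,
    ← Complex.ofReal_mul, f1, f2]
  push_cast
  rw [neg_smul, sub_neg_eq_add, add_comm]

/-- Group the sum into pairs `S`, `insert e S`: each pair is a bond on the edge labelled `e`, and
these add up linearly. -/
theorem bondState_eq_bond (hG : G.IsTree) {B : Finset V} {c : V → Bool} {e : V} (u v : B)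
    (huv : u ≠ v) (heB : e ∈ B) (he : e ≠ o) (hcu : c u = true) (hcv : c v = false)
    (hcount : ∀ S, e ∉ S → count G o B (insert e S) u = count G o B S u + 1 ∧
      count G o B (insert e S) v = count G o B S v + 1 ∧
      ∀ z, z ≠ (u : V) → z ≠ (v : V) → count G o B (insert e S) z = count G o B S z) :
    ∃ χ, bondState G o B c = (bond (fun v => G.degree v) B u v).mulVec χ := by
  have hBe : B.erase o = insert e ((B.erase o).erase e) :=
    (Finset.insert_erase (Finset.mem_erase.2 ⟨he, heB⟩)).symm
  have hpair : ∀ S ∈ ((B.erase o).erase e).powerset, ∃ χ,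
      ((amplitude G o B S : ℝ) : ℂ) • Pi.single (markedConf G o B c S) 1
      + ((amplitude G o B (insert e S) : ℝ) : ℂ) • Pi.single (markedConf G o B c (insert e S)) 1
      = (bond (fun v => G.degree v) B u v).mulVec χ := by
    intro S hS
    rw [Finset.mem_powerset] at hS
    have heS : e ∉ S := fun h => Finset.notMem_erase e _ (hS h)
    have hoS : o ∉ S := fun h => Finset.notMem_erase o _ (Finset.mem_of_mem_erase (hS h))
    obtain ⟨h1, h2, h3⟩ := hcount S heS
    exact exists_bond_eq_pair hG u v huv hoS heS he hcu hcv h1 h2 h3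
  choose! χ hχ using hpair
  refine ⟨∑ S ∈ ((B.erase o).erase e).powerset, χ S, ?_⟩
  have hsum : bondState G o B c = ∑ S ∈ ((B.erase o).erase e).powerset,
      (bond (fun v => G.degree v) B u v).mulVec (χ S) := by
    rw [← Finset.sum_congr rfl hχ, Finset.sum_add_distrib, bondState]
    conv_lhs => rw [hBe]
    exact Finset.sum_powerset_insert (Finset.notMem_erase e _) _
  rw [hsum]
  exact (map_sum (Matrix.mulVecLin (bond (fun v => G.degree v) B u v)) _ _).symm

/-- The alternating colouring makes a mark mean opposite kinds of bosons at the two ends of an edge,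
as in a singlet. Which end is coloured `true` affects only the sign of the bond. -/
theorem isBonded_bondState (hG : G.IsTree) (B : Finset V) {c : V → Bool}
    (hc : ∀ x y, G.Adj x y → c x = !c y) : IsBonded G B (bondState G o B c) := by
  have main : ∀ x p : B, (x : V) ∈ children G o p →
      ∃ χ, bondState G o B c = (bond (fun v => G.degree v) B x p).mulVec χ := by
    intro x p hxp
    have hadj := (mem_children.1 hxp).1
    have hpx : p ≠ x := fun h => hadj.ne (congrArg Subtype.val h)
    have hxo := ne_root_of_mem_children hxp
    have hcx := hc x p hadj.symm
    cases hcp : c p with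
    | false =>
      rw [hcp] at hcx
      exact bondState_eq_bond hG (e := x) x p hpx.symm x.2 hxo hcx hcp fun S hS =>
        ⟨count_insert_self hS, count_insert_parent hxp hS x.2,
          fun z hz hz' => count_insert_of_ne hG hxp hz hz'⟩
    | true =>
      rw [hcp] at hcx
      obtain ⟨χ, hχ⟩ := bondState_eq_bond hG (e := x) p x hpx x.2 hxo hcp hcx fun S hS =>
        ⟨count_insert_parent hxp hS x.2, count_insert_self hS,
          fun z hz hz' => count_insert_of_ne hG hxp hz' hz⟩
      refine ⟨-χ, ?_⟩
      rw [hχ, bond_swap hpx.symm, Matrix.neg_mulVec, Matrix.mulVec_neg]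
  intro x y hxy
  rcases mem_children_or (o := o) hG hxy with h | h
  · obtain ⟨χ, hχ⟩ := main y x h
    have hne : x ≠ y := fun h => hxy.ne (congrArg Subtype.val h)
    refine ⟨-χ, ?_⟩
    rw [hχ, bond_swap hne, Matrix.neg_mulVec, Matrix.mulVec_neg]
  · exact main x y h

/-- The marks are recovered from the deepest level upwards: once the edges below `x` are known, the
count at `x` decides the edge above it. -/
theorem markedConf_injOn (hG : G.IsTree) (B : Finset V) (c : V → Bool) :
    Set.InjOn (markedConf G o B c) ((B.erase o).powerset : Set (Finset V)) := by
  intro S hS T hT hST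
  rw [Finset.mem_coe, Finset.mem_powerset] at hS hT
  have hoS : o ∉ S := fun h => Finset.notMem_erase o _ (hS h)
  have hoT : o ∉ T := fun h => Finset.notMem_erase o _ (hT h)
  have hcount : ∀ x ∈ B, count G o B S x = count G o B T x := by
    intro x hx
    have h1 := congrArg Fin.val (congrFun hST ⟨x, hx⟩)
    rw [markedConf_val hG hoS, markedConf_val hG hoT] at h1
    have h2 := count_le (B := B) hG hoS x
    have h3 := count_le (B := B) hG hoT x
    split_ifs at h1
    · exact h1
    · dsimp only at h1; omega
  have key : ∀ m, ∀ x ∈ B, B.sup (G.dist o) - G.dist o x < m → (x ∈ S ↔ x ∈ T) := by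
    intro m
    induction m with
    | zero => intro x _ h; omega
    | succ m ih =>
      intro x hx hm
      have h1 := hcount x hx
      have h2 : (children G o x).filter (fun y => y ∈ B → y ∈ S) =
          (children G o x).filter fun y => y ∈ B → y ∈ T := by
        refine Finset.filter_congr fun y hy => forall_congr' fun hyB => ih y hyB ?_
        have h3 := (mem_children.1 hy).2
        have h4 := Finset.le_sup (f := G.dist o) hyB
        omega
      rw [count, count, h2] at h1
      split_ifs at h1 with h3 h4 h4
      · simp [h3, h4]
      · omega
      · omega
      · simp [h3, h4]
  ext x
  constructor
  · intro h
    exact (key _ x (Finset.mem_of_mem_erase (hS h)) (Nat.lt_succ_self _)).1 h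
  · intro h
    exact (key _ x (Finset.mem_of_mem_erase (hT h)) (Nat.lt_succ_self _)).2 h

/-- Injectivity of the configurations removes all interference, so the signs drop out and a
classical weight remains. -/
theorem sum_bondState (hG : G.IsTree) (B : Finset V) (c : V → Bool)
    (f : Conf (fun v => G.degree v) B → ℂ) :
    ∑ σ, bondState G o B c σ * star (bondState G o B c σ) * f σ =
      ∑ S ∈ (B.erase o).powerset,
        ((∏ x ∈ B, occ (G.degree x) (count G o B S x) : ℝ) : ℂ) * f (markedConf G o B c S) := by
  have hval : ∀ S ∈ (B.erase o).powerset,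
      bondState G o B c (markedConf G o B c S) = ((amplitude G o B S : ℝ) : ℂ) := by
    intro S hS
    rw [bondState, Finset.sum_apply, Finset.sum_eq_single S]
    · simp
    · intro T hT hTS
      have : markedConf G o B c S ≠ markedConf G o B c T := fun h =>
        hTS (markedConf_injOn hG B c hT hS h.symm)
      simp [this]
    · exact fun h => absurd hS h
  have hzero : ∀ σ, σ ∉ (B.erase o).powerset.image (markedConf G o B c) →
      bondState G o B c σ = 0 := by
    intro σ hσ
    rw [bondState, Finset.sum_apply]
    refine Finset.sum_eq_zero fun S hS => ?_
    have : σ ≠ markedConf G o B c S := fun h => hσ (Finset.mem_image.2 ⟨S, hS, h.symm⟩)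
    simp [this]
  rw [← Finset.sum_subset (Finset.subset_univ ((B.erase o).powerset.image (markedConf G o B c)))
    (fun σ _ hσ => by rw [hzero σ hσ]; simp), Finset.sum_image (markedConf_injOn hG B c)]
  refine Finset.sum_congr rfl fun S hS => ?_
  rw [hval S hS]
  congr 1
  rw [Complex.star_def, Complex.conj_ofReal, ← Complex.ofReal_mul, amplitude]
  congr 1
  rw [mul_mul_mul_comm, ← pow_add, Even.neg_one_pow ⟨_, rfl⟩, one_mul, ← Finset.prod_mul_distrib]
  exact Finset.prod_congr rfl fun x _ => Real.mul_self_sqrt (occ_pos _ _).le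

end State

/-! ### The magnetization at the root -/

section Magnetization

variable {V : Type*} [DecidableEq V] {G : SimpleGraph V} [G.LocallyFinite] {o : V}

theorem prod_downFactor {B : Finset V} {msg : V → ℝ → ℝ} (hout : ∀ y ∉ B, ∀ t, msg y t = t)
    (S : Finset V) (x : V) (t : ℝ) :
    ∏ y ∈ children G o x, downFactor B msg S y t =
      t ^ ((children G o x).filter fun y => y ∈ B → y ∈ S).card *
        (1 - t) ^ ((children G o x).card -
          ((children G o x).filter fun y => y ∈ B → y ∈ S).card) := by
  have h1 : ∀ y, downFactor B msg S y t = if y ∈ B → y ∈ S then t else 1 - t := by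
    intro y
    unfold downFactor
    by_cases hy : y ∈ B
    · simp [hy, edgeFactor]
    · simp [hy, hout y hy]
  simp only [h1]
  rw [Finset.prod_ite, Finset.prod_const, Finset.prod_const]
  congr 2
  have := Finset.card_filter_add_card_filter_not (s := children G o x) (fun y => y ∈ B → y ∈ S)
  omega

/-- An outside child with message `t` acts as a marked edge, so the integrand is `t` to the number
of marks times `1 - t` to the number of the others. -/
theorem vertexWeight_eq_occ (hG : G.IsTree) {B : Finset V} {msg : V → ℝ → ℝ}
    (hout : ∀ y ∉ B, ∀ t, msg y t = t) (φ : ℝ → ℝ) (S : Finset V) {x : V} (hx : x ≠ o) :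
    vertexWeight G o B msg φ S x = occ (G.degree x) (count G o B S x) := by
  rw [vertexWeight, occ, upFactor, if_neg hx, ← card_children hG hx, count]
  congr 1
  ext t
  rw [prod_downFactor hout, edgeFactor]
  have := Finset.card_filter_le (children G o x) fun y => y ∈ B → y ∈ S
  split_ifs
  · rw [pow_add, pow_one, mul_assoc]
    congr 3
    omega
  · rw [zero_add, Nat.sub_add_comm this, pow_succ]
    ring

theorem vertexWeight_root {B : Finset V} {msg : V → ℝ → ℝ}
    (hout : ∀ y ∉ B, ∀ t, msg y t = t) (φ : ℝ → ℝ) {S : Finset V} (hS : o ∉ S) :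
    vertexWeight G o B msg φ S o = ∫ t in (0 : ℝ)..1,
      φ t * (t ^ count G o B S o * (1 - t) ^ (G.degree o - count G o B S o)) := by
  rw [vertexWeight, upFactor, if_pos rfl, ← card_children_root, count, if_neg hS, zero_add]
  simp only [prod_downFactor hout]

theorem partition_one (hG : G.IsTree) {B : Finset V} {msg : V → ℝ → ℝ}
    (hout : ∀ y ∉ B, ∀ t, msg y t = t) :
    partition G o B msg (fun _ => 1) =
      ∑ S ∈ (B.erase o).powerset, ∏ x ∈ B, occ (G.degree x) (count G o B S x) := by
  refine Finset.sum_congr rfl fun S hS => Finset.prod_congr rfl fun x _ => ?_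
  by_cases hx : x = o
  · subst hx
    rw [vertexWeight_root hout _ fun h => Finset.notMem_erase x _ (Finset.mem_powerset.1 hS h)]
    simp [occ]
  · rw [vertexWeight_eq_occ hG hout _ _ hx]

theorem partition_magnetization (hG : G.IsTree) {B : Finset V} (ho : o ∈ B) {msg : V → ℝ → ℝ}
    (hout : ∀ y ∉ B, ∀ t, msg y t = t) :
    partition G o B msg (fun t => 2 * t - 1) = 2 / ((G.degree o : ℝ) + 2) *
      ∑ S ∈ (B.erase o).powerset, (∏ x ∈ B, occ (G.degree x) (count G o B S x)) *
        ((count G o B S o : ℝ) - (G.degree o : ℝ) / 2) := by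
  rw [partition, Finset.mul_sum]
  refine Finset.sum_congr rfl fun S hS => ?_
  have hoS : o ∉ S := fun h => Finset.notMem_erase o _ (Finset.mem_powerset.1 hS h)
  rw [← Finset.mul_prod_erase _ _ ho, ← Finset.mul_prod_erase _ _ ho, vertexWeight_root hout _ hoS,
    integral_mul_occ (count_le hG hoS o), Finset.prod_congr rfl fun x hx =>
      vertexWeight_eq_occ hG hout _ _ (Finset.ne_of_mem_erase hx)]
  ring

/-- The magnetization at the root in the state with a polarized boundary is bounded away from
zero, uniformly in the size of the ball. -/
theorem exists_le_magnetization [Infinite V] (hG : G.IsTree) (hleaf : ∀ v : V, G.degree v ≠ 1)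
    {μ C : ℝ} (hμ : 1 < μ) (hC : 0 < C)
    (hpath : ∀ p : ℕ → V, p 0 = o → (∀ k, G.Adj (p k) (p (k + 1))) →
      (∀ k, G.dist o (p k) = k) →
      ∀ n : ℕ, C * μ ^ n ≤ ∏ k ∈ Finset.Icc 1 n, ((G.degree (p k) : ℝ) - 1) / 3) :
    ∃ c > 0, ∀ n,
      c * ∑ S ∈ ((ball G o n).erase o).powerset,
        ∏ x ∈ ball G o n, occ (G.degree x) (count G o (ball G o n) S x) ≤
      ∑ S ∈ ((ball G o n).erase o).powerset,
        (∏ x ∈ ball G o n, occ (G.degree x) (count G o (ball G o n) S x)) *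
        ((count G o (ball G o n) S o : ℝ) - (G.degree o : ℝ) / 2) := by
  have hne := children_nonempty (o := o) hG hleaf o
  set K := 3 / (C * (1 - μ⁻¹)) with hK
  have hK0 : 0 ≤ K := by
    have : 0 < 1 - μ⁻¹ := by
      have := inv_lt_one_of_one_lt₀ hμ
      linarith
    positivity
  have hm : (0 : ℝ) < (children G o o).card := by exact_mod_cast hne.card_pos
  set L := 3 + 3 * K / (children G o o).card with hL
  have hL0 : 0 < L := by positivity
  have hd : (0 : ℝ) < (G.degree o : ℝ) + 2 := by positivity
  -- `L` bounds the ratio of the moments of `1` and `2t - 1` at the root; `(deg o + 2) / 2` converts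
  -- the latter to spin.
  refine ⟨((G.degree o : ℝ) + 2) / (2 * L), by positivity, fun n => ?_⟩
  set B := ball G o n with hB
  have hmemB : ∀ x, x ∈ B ↔ G.dist o x ≤ n := fun x => mem_ball G hG.connected o x n
  have hoB : o ∈ B := by simp [hmemB]
  -- Truncated subtraction makes the level `0`, hence the message `t`, everywhere outside the ball.
  set msg : V → ℝ → ℝ := fun y => message G o (n + 1 - G.dist o y) y with hmsg
  have hcont : ∀ y, Continuous (msg y) := fun y => continuous_message G o _ y
  have hout : ∀ y ∉ B, ∀ t, msg y t = t := by
    intro y hy t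
    rw [hmemB] at hy
    simp only [hmsg]
    rw [show n + 1 - G.dist o y = 0 by omega]
    rfl
  have hclosed : ∀ x p, x ∈ B → x ∈ children G o p → p ∈ B := by
    intro x p hx hxp
    rw [hmemB] at hx ⊢
    have := (mem_children.1 hxp).2
    omega
  have hrec : ∀ x ∈ B, x ≠ o → ∀ t, msg x t =
      t * (∫ s in (0 : ℝ)..1, s * ∏ z ∈ children G o x, msg z s)
        + (1 - t) * ∫ s in (0 : ℝ)..1, (1 - s) * ∏ z ∈ children G o x, msg z s := by
    intro x hx _ t
    rw [hmemB] at hx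
    have hz : ∀ s, ∏ z ∈ children G o x, msg z s =
        ∏ z ∈ children G o x, message G o (n - G.dist o x) z s := by
      intro s
      refine Finset.prod_congr rfl fun z hz => ?_
      have := (mem_children.1 hz).2
      simp only [hmsg]
      rw [show n + 1 - G.dist o z = n - G.dist o x by omega]
    simp only [hz]
    simp only [hmsg]
    rw [show n + 1 - G.dist o x = (n - G.dist o x) + 1 by omega]
    rfl
  -- At `ℓ = 0` the product is empty and the bound is `K`, independent of `n`.
  have htilt : ∀ y ∈ children G o o, IsTilted (msg y) K := by
    intro y hy
    have hdesc : IsDescending G o (Function.update (fun _ => o) 1 y) (0 + 1) :=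
      IsDescending.update (G := G) (o := o) (p := fun _ => o) ⟨rfl, by omega⟩ hy
    have := isTilted_message hG hleaf hμ hC hpath (n + 1 - G.dist o y) _ 0 hdesc
    simpa using this
  obtain ⟨-, -, -, hlow⟩ := IsTilted.prod hne htilt
  have hD := partition_eq hG hcont (φ := fun _ => 1) (by fun_prop) B hoB hclosed hrec
  have hN := partition_eq hG hcont (φ := fun t => 2 * t - 1) (by fun_prop) B hoB hclosed hrec
  simp only [one_mul] at hD
  rw [← hD, ← hN, partition_one hG hout, partition_magnetization hG hoB hout] at hlow
  rw [div_mul_eq_mul_div, div_le_iff₀ (by positivity)]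
  rw [← mul_assoc, mul_div_assoc', div_mul_eq_mul_div, le_div_iff₀ hd] at hlow
  linarith

end Magnetization

/-! ### Two ground states -/

section Final

variable {V : Type*} [DecidableEq V] {G : SimpleGraph V} [G.LocallyFinite] {o : V}

/-- The third component of the spin at the root. -/
def rootSpin (G : SimpleGraph V) [G.LocallyFinite] (o : V) : Obs (fun v => G.degree v) {o} :=
  Matrix.diagonal fun σ =>
    (((σ ⟨o, Finset.mem_singleton_self o⟩ : Fin _) : ℕ) : ℂ) - (G.degree o : ℂ) / 2

theorem expectation_rootSpin {B : Finset V} (ho : o ∈ B)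
    (ψ : Conf (fun v => G.degree v) B → ℂ) :
    expectation (Matrix.vecMulVec ψ (star ψ)) {o} (rootSpin G o) =
      ∑ σ, ψ σ * star (ψ σ) * ((((σ ⟨o, ho⟩ : Fin _) : ℕ) : ℂ) - (G.degree o : ℂ) / 2) := by
  have hsub : ({o} : Finset V) ⊆ B := Finset.singleton_subset_iff.2 ho
  have hext : extend hsub (rootSpin G o) = Matrix.diagonal fun σ : Conf (fun v => G.degree v) B =>
      (((σ ⟨o, ho⟩ : Fin _) : ℕ) : ℂ) - (G.degree o : ℂ) / 2 := by
    ext σ τ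
    simp only [extend, rootSpin, Matrix.of_apply, Matrix.diagonal_apply, ← ite_and]
    congr 1
    rw [eq_iff_iff]
    constructor
    · rintro ⟨h1, h2⟩
      funext y
      by_cases hy : (y : V) ∈ ({o} : Finset V)
      · exact congrFun h2 ⟨y, hy⟩
      · exact h1 y hy
    · rintro rfl
      exact ⟨fun _ _ => rfl, rfl⟩
  rw [expectation, dif_pos hsub, hext, Matrix.trace]
  refine Finset.sum_congr rfl fun σ _ => ?_
  rw [Matrix.diag_apply, Matrix.mul_diagonal, Matrix.vecMulVec_apply, Pi.star_apply]

/-- There is an infinite-volume ground state in which the magnetization of the root is a limit of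
that in the polarized bond states. -/
theorem exists_infiniteVolumeGroundState_rootSpin [DecidableRel G.Adj] (hG : G.IsTree)
    {c : V → Bool} (hc : ∀ x y, G.Adj x y → c x = !c y) :
    ∃ ω ∈ infiniteVolumeGroundStates G o,
      Tendsto (fun n => (((if c o then 1 else -1) *
        ((∑ S ∈ ((ball G o n).erase o).powerset,
          (∏ x ∈ ball G o n, occ (G.degree x) (count G o (ball G o n) S x)) *
            ((count G o (ball G o n) S o : ℝ) - (G.degree o : ℝ) / 2)) /
        ∑ S ∈ ((ball G o n).erase o).powerset,
          ∏ x ∈ ball G o n, occ (G.degree x) (count G o (ball G o n) S x)) : ℝ) : ℂ))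
      (hyperfilter ℕ : Filter ℕ) (𝓝 (ω {o} (rootSpin G o))) := by
  set Z : ℕ → ℝ := fun n => ∑ S ∈ ((ball G o n).erase o).powerset,
    ∏ x ∈ ball G o n, occ (G.degree x) (count G o (ball G o n) S x) with hZ
  have hZ0 : ∀ n, 0 < Z n := fun n =>
    Finset.sum_pos (fun S _ => Finset.prod_pos fun x _ => occ_pos _ _)
      ⟨∅, Finset.empty_mem_powerset _⟩
  set r : ℕ → ℂ := fun n => (((Real.sqrt (Z n))⁻¹ : ℝ) : ℂ) with hr
  have hr2 : ∀ n, r n * star (r n) = (((Z n)⁻¹ : ℝ) : ℂ) := by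
    intro n
    rw [Complex.star_def, Complex.conj_ofReal, ← Complex.ofReal_mul, ← mul_inv,
      Real.mul_self_sqrt (hZ0 n).le]
  have hsum : ∀ n (f : Conf (fun v => G.degree v) (ball G o n) → ℂ),
      ∑ σ, (r n • bondState G o (ball G o n) c) σ *
        star ((r n • bondState G o (ball G o n) c) σ) * f σ =
      (((Z n)⁻¹ : ℝ) : ℂ) * ∑ S ∈ ((ball G o n).erase o).powerset,
        ((∏ x ∈ ball G o n, occ (G.degree x) (count G o (ball G o n) S x) : ℝ) : ℂ) *
          f (markedConf G o (ball G o n) c S) := by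
    intro n f
    rw [← sum_bondState hG, Finset.mul_sum, ← hr2]
    refine Finset.sum_congr rfl fun σ _ => ?_
    rw [Pi.smul_apply, smul_eq_mul, star_mul']
    ring
  obtain ⟨ω, hω, hlim⟩ := exists_infiniteVolumeGroundState hG.connected o
    (fun n => r n • bondState G o (ball G o n) c)
    (fun n => (isBonded_bondState hG _ hc).smul _) (fun n => by
      have := hsum n fun _ => 1
      simp only [mul_one] at this
      rw [dotProduct]
      refine this.trans ?_
      rw [← Complex.ofReal_sum, ← Complex.ofReal_mul, inv_mul_cancel₀ (hZ0 n).ne',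
        Complex.ofReal_one])
  refine ⟨ω, hω, (hlim {o} (rootSpin G o)).congr fun n => ?_⟩
  have ho : o ∈ ball G o n := by simp [mem_ball G hG.connected]
  rw [expectation_rootSpin ho, hsum n fun σ =>
    (((σ ⟨o, ho⟩ : Fin _) : ℕ) : ℂ) - (G.degree o : ℂ) / 2]
  -- Replacing `count` by `deg o - count` reflects the spin, so the colour of the root enters only
  -- as a sign.
  have hspin : ∀ S ∈ ((ball G o n).erase o).powerset,
      ((((markedConf G o (ball G o n) c S) ⟨o, ho⟩ : Fin _) : ℕ) : ℂ) - (G.degree o : ℂ) / 2 =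
      (((if c o then 1 else -1) *
        ((count G o (ball G o n) S o : ℝ) - (G.degree o : ℝ) / 2) : ℝ) : ℂ) := by
    intro S hS
    have hoS : o ∉ S := fun h => Finset.notMem_erase o _ (Finset.mem_powerset.1 hS h)
    rw [markedConf_val hG hoS]
    cases c o
    · simp only [Bool.false_eq_true, if_false]
      rw [Nat.cast_sub (count_le hG hoS o)]
      push_cast
      ring
    · simp
  rw [Finset.sum_congr rfl fun S hS => by rw [hspin S hS, ← Complex.ofReal_mul],
    ← Complex.ofReal_sum, ← Complex.ofReal_mul]
  congr 1
  simp only [mul_left_comm _ (if c o then (1 : ℝ) else -1)]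
  rw [← Finset.mul_sum, mul_left_comm, ← div_eq_inv_mul]

end Final
end AKLT
end

/-! ### Nonuniqueness from the two Néel boundary conditions. -/

theorem mainTheorem3 {V : Type*} [DecidableEq V] [Infinite V] (G : SimpleGraph V)
    [G.LocallyFinite] [DecidableRel G.Adj] (hG : G.IsTree) (o : V)
    (hleaf : ∀ v : V, G.degree v ≠ 1) (μ C : ℝ) (hμ : 1 < μ) (hC : 0 < C)
    (hpath : ∀ p : ℕ → V, p 0 = o → (∀ k, G.Adj (p k) (p (k + 1))) →
      (∀ k, G.dist o (p k) = k) →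
      ∀ n : ℕ, C * μ ^ n ≤ ∏ k ∈ Finset.Icc 1 n, ((G.degree (p k) : ℝ) - 1) / 3) :
    ∃ ω₁ ∈ AKLT.infiniteVolumeGroundStates G o, ∃ ω₂ ∈ AKLT.infiniteVolumeGroundStates G o,
      ω₁ ≠ ω₂ := by
  have hodd : ∀ x y, G.Adj x y → decide (Odd (G.dist o x)) = !decide (Odd (G.dist o y)) := by
    intro x y hxy
    rcases hG.dist_eq_dist_add_one_of_adj o hxy with h | h <;> 
      simp [h, Nat.odd_add_one, -Nat.not_odd_iff_even]
  -- The two proper 2-colourings, by parity of the depth, give the two boundary conditions; the root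
  -- is `true` in the first and `false` in the second.
  obtain ⟨ω₁, hω₁, hlim₁⟩ := AKLT.exists_infiniteVolumeGroundState_rootSpin (o := o) hG
    (c := fun x => !decide (Odd (G.dist o x))) (fun x y hxy => by simp only [hodd x y hxy])
  obtain ⟨ω₂, hω₂, hlim₂⟩ := AKLT.exists_infiniteVolumeGroundState_rootSpin (o := o) hG
    (c := fun x => decide (Odd (G.dist o x))) hodd
  refine ⟨ω₁, hω₁, ω₂, hω₂, ?_⟩
  -- If the states coincided, one number would be both at least `c` and at most `-c`.
  rintro rfl
  obtain ⟨c, hc, hmag⟩ := AKLT.exists_le_magnetization hG hleaf hμ hC hpath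
  have h1 := (Complex.continuous_re.tendsto _).comp hlim₁
  have h2 := (Complex.continuous_re.tendsto _).comp hlim₂
  have hle : ∀ n, c ≤ (∑ S ∈ ((AKLT.ball G o n).erase o).powerset,
        (∏ x ∈ AKLT.ball G o n,
          AKLT.occ (G.degree x) (AKLT.count G o (AKLT.ball G o n) S x)) *
          ((AKLT.count G o (AKLT.ball G o n) S o : ℝ) - (G.degree o : ℝ) / 2)) /
      ∑ S ∈ ((AKLT.ball G o n).erase o).powerset,
        ∏ x ∈ AKLT.ball G o n, AKLT.occ (G.degree x) (AKLT.count G o (AKLT.ball G o n) S x) := by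
    intro n
    rw [le_div_iff₀]
    · exact hmag n
    · exact Finset.sum_pos (fun S _ => Finset.prod_pos fun x _ => AKLT.occ_pos _ _)
        ⟨∅, Finset.empty_mem_powerset _⟩
  have e1 : (if !decide (Odd (G.dist o o)) then (1 : ℝ) else -1) = 1 := by simp
  have e2 : (if decide (Odd (G.dist o o)) then (1 : ℝ) else -1) = -1 := by simp
  have h3 : c ≤ _ := ge_of_tendsto h1 (Eventually.of_forall fun n => by
    simp only [Function.comp_apply, Complex.ofReal_re]
    rw [e1, one_mul]
    exact hle n)
  have h4 : _ ≤ -c := le_of_tendsto h2 (Eventually.of_forall fun n => by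
    simp only [Function.comp_apply, Complex.ofReal_re]
    rw [e2, neg_one_mul]
    exact neg_le_neg (hle n))
  linarith
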